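/- Let $(N_n)_{n\ge1}$ be integers $N_n\ge 2$ and let $B_n\subset\{0,1,\dots,N_n-1\}$ be non-empty. For a finite non-empty set $A\subset\mathbb R$ put $\delta_A=\frac1{\#A}\sum_{a\in A}\delta_a$, and let $$\mu=\mu(N_n,B_n)=\delta_{\frac1{N_1}B_1}*\delta_{\frac1{N_1N_2}B_2}*\delta_{\frac1{N_1N_2N_3}B_3}*\cdots$$ (an infinite convolution, that is, the weak limit of the finite convolutions) be the associated Cantor-Moran measure. Let $\mu_{>n}$ be the infinite convolution of all the factors except the first $n$, let $\nu_{>n}(E)=\mu_{>n}((N_1\cdots N_n)^{-1}E)$, and let $\rho=\frac12(\delta_0+\delta_1)$. For an integer $N\ge2$ and finite sets $B,L\subset\mathbb Z$ with $M=\#B\geq 1$, consider the linear map $H:\mathbb C^B\to\mathbb C^L$, $(H\mathbf w)_l=\frac1{\sqrt M}\sum_{b\in B}e^{-2\pi i bl/N}w_b$. The triple $(N,B,L)$ is a Hadamard triple if $\#L=\#B\le N$ and the matrix $\frac1{\sqrt M}[e^{-2\pi i bl/N}]_{b\in B,l\in L}$ is unitary. A sequence $\{(N_n,B_n,L_n)\}$,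 with associated maps $H_n$, is a frame triple tower if there are $0\le\epsilon_n<1$ with $\sum_n\epsilon_n<\infty$ and $(1-\epsilon_n)\|\mathbf w\|\le\|H_n\mathbf w\|\le(1+\epsilon_n)\|\mathbf w\|$ for all $n$ and all $\mathbf w\in\mathbb C^{B_n}$ (Euclidean norms). A Borel probability measure $\mu$ on $\mathbb R$ is spectral with spectrum $\Lambda$ if $\Lambda\subset\mathbb R$ is countable and $\{e^{2\pi i\lambda x}\}_{\lambda\in\Lambda}$ is an orthonormal basis of $L^2(\mu)$. It is frame-spectral with frame spectrum $\Lambda$ if there are $0<A\le C<\infty$ with $A\|f\|_{L^2(\mu)}^2\le\sum_{\lambda\in\Lambda}\left|\int f(x)e^{-2\pi i\lambda x}\,d\mu(x)\right|^2\le C\|f\|_{L^2(\mu)}^2$ for all $f\in L^2(\mu)$. **Theorem 1.3.** Suppose that $\{\nu_{>n}\}$ does not converge weakly to $\rho$ as $n\to\infty$. (i) If every $(N_n,B_n,L_n)$ is a Hadamard triple for some finite sets $L_n\subset\mathbb Z$, then $\mu(N_n,B_n)$ is a spectral measure, and it admits a spectrum $\Lambda\subset\mathbb Z$. (ii) If $\{(N_n,B_n,L_n)\}$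 is a frame triple tower for some finite sets $L_n\subset\mathbb Z$, then $\mu(N_n,B_n)$ is a frame-spectral measure, and it admits a frame spectrum $\Lambda\subset\mathbb Z$. -/

import Mathlib

open MeasureTheory Filter Topology

noncomputable section

/-! Throughout, sequences are indexed by `ℕ` starting from `0`: the terms `N 0, N 1, …` are
the integers `N_1, N_2, …`, and similarly for `B` and `L`. -/

/-! ### Hadamard triples and frame triples -/

/-- The matrix `H = (1/√M) [exp (-2πi b l / N)]`, `b ∈ B`, `l ∈ L`, where `M = #B`. -/
def expMatrix (N : ℕ) (B L : Finset ℤ) : Matrix B L ℂ :=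
  Matrix.of fun b l =>
    ((1 / Real.sqrt (B.card : ℝ) : ℝ) : ℂ) *
      Complex.exp (-2 * Real.pi * Complex.I * ((b : ℤ) : ℂ) * ((l : ℤ) : ℂ) / (N : ℂ))

/-- `(N, B, L)` is a Hadamard triple: `N ≥ 2`, `#L = #B ≤ N` and `H` is unitary. -/
structure IsHadamardTriple (N : ℕ) (B L : Finset ℤ) : Prop where
  two_le : 2 ≤ N
  card_eq : L.card = B.card
  card_le : B.card ≤ N
  unitary : (expMatrix N B L).conjTranspose * expMatrix N B L = 1

/-- `(N, B, L)` is a frame triple with constants `0 < c₁ ≤ c₂`: for every vector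
`w = (w_b)_{b ∈ B}`, the vector `H w = ((1/√M) ∑_b exp (-2πi b l / N) w_b)_{l ∈ L}` satisfies
`c₁ ‖w‖ ≤ ‖H w‖ ≤ c₂ ‖w‖` for the Euclidean norms. As `expMatrix` has its rows indexed by `B`,
the map `w ↦ H w` is given by its transpose. -/
structure IsFrameTriple (N : ℕ) (B L : Finset ℤ) (c₁ c₂ : ℝ) : Prop where
  two_le : 2 ≤ N
  pos : 0 < c₁
  le : c₁ ≤ c₂
  lower : ∀ w : EuclideanSpace ℂ B,
    c₁ * ‖w‖ ≤ ‖WithLp.toLp 2 ((expMatrix N B L).transpose.mulVec w.ofLp)‖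
  upper : ∀ w : EuclideanSpace ℂ B,
    ‖WithLp.toLp 2 ((expMatrix N B L).transpose.mulVec w.ofLp)‖ ≤ c₂ * ‖w‖

/-- Frame triple tower: the `n`-th triple is a frame triple with constants `1 - ε n` and
`1 + ε n`, where `0 ≤ ε n < 1` and `∑ ε n < ∞`. -/
def IsFrameTripleTower (N : ℕ → ℕ) (B L : ℕ → Finset ℤ) : Prop :=
  ∃ ε : ℕ → ℝ, (∀ n, 0 ≤ ε n ∧ ε n < 1) ∧ Summable ε ∧
    ∀ n, IsFrameTriple (N n) (B n) (L n) (1 - ε n) (1 + ε n)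

/-! ### Spectral and frame-spectral measures -/

/-- `Λ` is a spectrum for the Borel probability measure `μ` on `ℝ`: it is countable and the
exponentials `x ↦ exp (2πi l x)`, `l ∈ Λ`, form an orthonormal basis of `L²(μ)`. -/
def IsSpectrum (μ : Measure ℝ) (Λ : Set ℝ) : Prop :=
  IsProbabilityMeasure μ ∧ Λ.Countable ∧
    ∃ e : HilbertBasis Λ ℂ (Lp ℂ 2 μ), ∀ l : Λ,
      (e l : ℝ → ℂ) =ᵐ[μ] fun x => Complex.exp (2 * Real.pi * Complex.I * (l : ℝ) * x)

/-- Spectral measures on `ℝ`. -/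
def IsSpectralMeasure (μ : Measure ℝ) : Prop := ∃ Λ : Set ℝ, IsSpectrum μ Λ

/-- `Λ` is a frame spectrum for the Borel probability measure `μ` on `ℝ`: the exponentials
`x ↦ exp (2πi l x)`, `l ∈ Λ`, form a Fourier frame for `μ`. -/
def IsFrameSpectrum (μ : Measure ℝ) (Λ : Set ℝ) : Prop :=
  IsProbabilityMeasure μ ∧
    ∃ A C : NNReal, 0 < A ∧ A ≤ C ∧ ∀ f : ℝ → ℂ, MemLp f 2 μ →
      (A : ENNReal) * ∫⁻ x, ‖f x‖ₑ ^ 2 ∂μ ≤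
          ∑' l : Λ, ‖∫ x, f x * Complex.exp (-2 * Real.pi * Complex.I * (l : ℝ) * x) ∂μ‖ₑ ^ 2 ∧
        ∑' l : Λ, ‖∫ x, f x * Complex.exp (-2 * Real.pi * Complex.I * (l : ℝ) * x) ∂μ‖ₑ ^ 2 ≤
          (C : ENNReal) * ∫⁻ x, ‖f x‖ₑ ^ 2 ∂μ

/-- Frame-spectral measures on `ℝ`. -/
def IsFrameSpectralMeasure (μ : Measure ℝ) : Prop := ∃ Λ : Set ℝ, IsFrameSpectrum μ Λ

/-! ### Weak convergence and infinite convolutions -/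

/-- Weak convergence of a sequence of measures on `ℝ`. -/
def WeaklyConverges (m : ℕ → Measure ℝ) (m' : Measure ℝ) : Prop :=
  ∀ f : BoundedContinuousFunction ℝ ℝ, Tendsto (fun n => ∫ x, f x ∂(m n)) atTop (𝓝 (∫ x, f x ∂m'))

/-- The finite convolution `m 0 ∗ m 1 ∗ ⋯ ∗ m (n - 1)` (the unit mass at `0` if `n = 0`). -/
def finConv (m : ℕ → Measure ℝ) : ℕ → Measure ℝ
  | 0 => Measure.dirac 0
  | n + 1 => Measure.conv (finConv m n) (m n)

/-- The infinite convolution `m 0 ∗ m 1 ∗ m 2 ∗ ⋯` of probability measures: the law of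
`∑ k, X k` for independent `X k` with laws `m k`. It is the weak limit of the
finite convolutions, see `weaklyConverges_infConv` below. -/
def infConv (m : ℕ → Measure ℝ) : Measure ℝ :=
  (Measure.infinitePi m).map fun x => ∑' k, x k

/-- `δ_A = (1/#A) ∑_{a ∈ A} δ_a` for a finite set `A`. -/
def uniformDirac (A : Finset ℝ) : Measure ℝ :=
  (A.card : ENNReal)⁻¹ • ∑ a ∈ A, Measure.dirac a

/-! ### Cantor-Moran measures -/

/-- The factor `δ_{(N_1 ⋯ N_{k+1})⁻¹ B_{k+1}}` of the Cantor-Moran measure. -/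
def cantorMoranFactor (N : ℕ → ℕ) (B : ℕ → Finset ℤ) (k : ℕ) : Measure ℝ :=
  uniformDirac ((B k).image fun b : ℤ => (b : ℝ) / ∏ j ∈ Finset.range (k + 1), (N j : ℝ))

/-- The Cantor-Moran measure `μ(N_n, B_n)`. -/
def cantorMoran (N : ℕ → ℕ) (B : ℕ → Finset ℤ) : Measure ℝ :=
  infConv (cantorMoranFactor N B)

/-- The tail `μ_{>n}`: the infinite convolution of all factors except the first `n`. -/
def cantorMoranTail (N : ℕ → ℕ) (B : ℕ → Finset ℤ) (n : ℕ) : Measure ℝ :=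
  infConv fun k => cantorMoranFactor N B (n + k)

/-- The rescaled tail `ν_{>n}(E) = μ_{>n}((N_1 ⋯ N_n)⁻¹ E)`. -/
def rescaledTail (N : ℕ → ℕ) (B : ℕ → Finset ℤ) (n : ℕ) : Measure ℝ :=
  (cantorMoranTail N B n).map fun x => (∏ j ∈ Finset.range n, (N j : ℝ)) * x

/-- `ρ = (δ_0 + δ_1) / 2`. -/
def rhoMeasure : Measure ℝ :=
  (2 : ENNReal)⁻¹ • (Measure.dirac (0 : ℝ) + Measure.dirac (1 : ℝ))

end

/-! ### The infinite convolutions above are the weak limits of the finite ones -/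

theorem uniformDirac_isProbabilityMeasure {A : Finset ℝ} (hA : A.Nonempty) :
    IsProbabilityMeasure (uniformDirac A) := by
  constructor
  have h : (A.card : ENNReal) ≠ 0 := by simpa using hA.ne_empty
  simp [uniformDirac, ENNReal.inv_mul_cancel h (ENNReal.natCast_ne_top _)]

theorem map_sum_infinitePi (m : ℕ → Measure ℝ) [∀ k, IsProbabilityMeasure (m k)] (n : ℕ) :
    (Measure.infinitePi m).map (fun x => ∑ k ∈ Finset.range n, x k) = finConv m n := by
  induction n with
  | zero => simp [finConv]
  | succ n ih =>
    have hind : ProbabilityTheory.iIndepFun (fun (i : ℕ) (x : ℕ → ℝ) => x i)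
        (Measure.infinitePi m) :=
      ProbabilityTheory.iIndepFun_infinitePi (X := fun _ x => x) (by fun_prop)
    have h2 := hind.indepFun_finsetSum_of_notMem (s := Finset.range n) (i := n)
      (by fun_prop) (by simp)
    have h3 := h2.map_add_eq_map_conv_map (by fun_prop) (by fun_prop)
    have e1 : (∑ j ∈ Finset.range n, fun x : ℕ → ℝ => x j)
        = fun x => ∑ k ∈ Finset.range n, x k := by
      ext x; simp
    rw [e1, ih, Measure.infinitePi_map_eval] at h3
    rw [finConv, ← h3]
    congr 1
    ext x
    simp [Finset.sum_range_succ]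

theorem ae_abs_le_infinitePi (m : ℕ → Measure ℝ) [∀ k, IsProbabilityMeasure (m k)]
    (u : ℕ → ℝ) (h : ∀ k, ∀ᵐ x ∂(m k), |x| ≤ u k) :
    ∀ᵐ x ∂(Measure.infinitePi m), ∀ k, |x k| ≤ u k := by
  rw [ae_all_iff]
  intro k
  have h' := h k
  rw [← Measure.infinitePi_map_eval m k] at h'
  exact ae_of_ae_map (measurable_pi_apply k).aemeasurable h'

theorem tendsto_sum_infinitePi (m : ℕ → Measure ℝ) [∀ k, IsProbabilityMeasure (m k)]
    (u : ℕ → ℝ) (hu : Summable u) (h : ∀ k, ∀ᵐ x ∂(m k), |x| ≤ u k) :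
    ∀ᵐ x ∂(Measure.infinitePi m),
      Tendsto (fun n => ∑ k ∈ Finset.range n, x k) atTop (𝓝 (∑' k, x k)) := by
  refine (ae_abs_le_infinitePi m u h).mono fun x hx => ?_
  have hx' : Summable x := Summable.of_norm_bounded hu hx
  exact hx'.hasSum.tendsto_sum_nat

theorem aemeasurable_tsum_infinitePi (m : ℕ → Measure ℝ) [∀ k, IsProbabilityMeasure (m k)]
    (u : ℕ → ℝ) (hu : Summable u) (h : ∀ k, ∀ᵐ x ∂(m k), |x| ≤ u k) :
    AEMeasurable (fun x : ℕ → ℝ => ∑' k, x k) (Measure.infinitePi m) := by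
  have hm : ∀ n : ℕ, AEMeasurable (fun x : ℕ → ℝ => ∑ k ∈ Finset.range n, x k)
      (Measure.infinitePi m) := fun n => (Finset.measurable_fun_sum _
      fun k _ => measurable_pi_apply k).aemeasurable
  exact aemeasurable_of_tendsto_metrizable_ae atTop hm (tendsto_sum_infinitePi m u hu h)

theorem infConv_isProbabilityMeasure (m : ℕ → Measure ℝ) [∀ k, IsProbabilityMeasure (m k)]
    (u : ℕ → ℝ) (hu : Summable u) (h : ∀ k, ∀ᵐ x ∂(m k), |x| ≤ u k) :
    IsProbabilityMeasure (infConv m) :=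
  Measure.isProbabilityMeasure_map (aemeasurable_tsum_infinitePi m u hu h)

theorem weaklyConverges_infConv (m : ℕ → Measure ℝ) [∀ k, IsProbabilityMeasure (m k)]
    (u : ℕ → ℝ) (hu : Summable u) (h : ∀ k, ∀ᵐ x ∂(m k), |x| ≤ u k) :
    WeaklyConverges (finConv m) (infConv m) := by
  have h1 := tendsto_sum_infinitePi m u hu h
  have h2 := aemeasurable_tsum_infinitePi m u hu h
  intro f
  have e : ∀ n, ∫ x, f x ∂(finConv m n)
      = ∫ x, f (∑ k ∈ Finset.range n, x k) ∂(Measure.infinitePi m) := by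
    intro n
    rw [← map_sum_infinitePi m n, integral_map (by fun_prop)
      f.continuous.aestronglyMeasurable]
  simp_rw [e]
  rw [infConv, integral_map h2 f.continuous.aestronglyMeasurable]
  refine tendsto_integral_of_dominated_convergence (fun _ => ‖f‖) (fun n => ?_)
    (integrable_const _) (fun n => ae_of_all _ fun x => f.norm_coe_le_norm _) ?_
  · exact (f.continuous.measurable.comp (by fun_prop)).aestronglyMeasurable
  · filter_upwards [h1] with x hx
    exact (f.continuous.tendsto _).comp hx

theorem cantorMoranFactor_spec {N : ℕ → ℕ} {B : ℕ → Finset ℤ} (hN : ∀ n, 2 ≤ N n)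
    (hne : ∀ n, (B n).Nonempty) (hB : ∀ n, B n ⊆ Finset.Ico 0 (N n : ℤ)) (k : ℕ) :
    IsProbabilityMeasure (cantorMoranFactor N B k) ∧
      ∀ᵐ x ∂(cantorMoranFactor N B k), |x| ≤ (1 / 2 : ℝ) ^ k := by
  refine ⟨uniformDirac_isProbabilityMeasure ((hne k).image _), ?_⟩
  have hsub : ∀ b ∈ B k, |(b : ℝ) / ∏ j ∈ Finset.range (k + 1), (N j : ℝ)| ≤ (1 / 2 : ℝ) ^ k := by
    intro b hb
    have hb' := Finset.mem_Ico.1 (hB k hb)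
    have h0 : (0 : ℝ) ≤ b := by exact_mod_cast hb'.1
    have h1 : (b : ℝ) ≤ N k := by exact_mod_cast hb'.2.le
    have hNk : (0 : ℝ) < N k := by have := hN k; positivity
    have hP : (2 : ℝ) ^ k ≤ ∏ j ∈ Finset.range k, (N j : ℝ) := by
      calc (2 : ℝ) ^ k = ∏ j ∈ Finset.range k, (2 : ℝ) := by simp
        _ ≤ _ := Finset.prod_le_prod (by simp) (fun j _ => by exact_mod_cast hN j)
    have hP0 : (0 : ℝ) < ∏ j ∈ Finset.range k, (N j : ℝ) := lt_of_lt_of_le (by positivity) hP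
    rw [Finset.prod_range_succ, abs_of_nonneg (by positivity), div_le_iff₀ (by positivity)]
    have : 1 ≤ (1 / 2 : ℝ) ^ k * ∏ j ∈ Finset.range k, (N j : ℝ) := by
      calc (1 : ℝ) = (1 / 2 : ℝ) ^ k * 2 ^ k := by rw [← mul_pow]; norm_num
        _ ≤ _ := by gcongr
    nlinarith
  rw [cantorMoranFactor, uniformDirac, ae_iff]
  simp only [Measure.smul_apply, Measure.finsetSum_apply, smul_eq_mul, mul_eq_zero]
  right
  refine Finset.sum_eq_zero fun a ha => ?_
  obtain ⟨b, hb, rfl⟩ := Finset.mem_image.1 ha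
  rw [← ae_iff, ae_dirac_iff (measurableSet_le (by fun_prop) (by fun_prop))]
  exact hsub b hb

theorem weaklyConverges_cantorMoranTail {N : ℕ → ℕ} {B : ℕ → Finset ℤ} (hN : ∀ n, 2 ≤ N n)
    (hne : ∀ n, (B n).Nonempty) (hB : ∀ n, B n ⊆ Finset.Ico 0 (N n : ℤ)) (n : ℕ) :
    IsProbabilityMeasure (cantorMoranTail N B n) ∧
      WeaklyConverges (finConv fun k => cantorMoranFactor N B (n + k))
        (cantorMoranTail N B n) := by
  have hs := cantorMoranFactor_spec hN hne hB
  have : ∀ k, IsProbabilityMeasure (cantorMoranFactor N B (n + k)) := fun k => (hs _).1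
  have hu : Summable fun k : ℕ => (1 / 2 : ℝ) ^ (n + k) := by
    simp_rw [pow_add]
    exact summable_geometric_two.mul_left _
  exact ⟨infConv_isProbabilityMeasure _ _ hu fun k => (hs _).2,
    weaklyConverges_infConv _ _ hu fun k => (hs _).2⟩

theorem weaklyConverges_cantorMoran {N : ℕ → ℕ} {B : ℕ → Finset ℤ} (hN : ∀ n, 2 ≤ N n)
    (hne : ∀ n, (B n).Nonempty) (hB : ∀ n, B n ⊆ Finset.Ico 0 (N n : ℤ)) :
    IsProbabilityMeasure (cantorMoran N B) ∧
      WeaklyConverges (finConv (cantorMoranFactor N B)) (cantorMoran N B) := by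
  simpa [cantorMoranTail, cantorMoran] using weaklyConverges_cantorMoranTail hN hne hB 0

/-!
Write `m_n` for the finite convolution of the first `n` factors, `τ_n` for the tail, so that
`μ = m_n ∗ τ_n`, and `ν_n` for the rescaled tail, which lives on `[0, 1]`. Let `P_n = N_1 ⋯ N_n`.

The finite measures `m_n` have integer Fourier frames for the obvious reason: composing the frames
of the single digit sets gives the frequencies `l_1 + P_1 l_2 + ⋯ + P_(n-1) l_n`, with the products
of the frame constants (`LevelFrame.succ`). As `m_n` is carried by `P_n⁻¹ ℤ`, every frequency may be
changed by a multiple of `P_n` (`LevelFrame.image_add_scale_mul`). The upper bound passes from `m_n`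
to `μ = m_n ∗ τ_n` by integration over the second variable. The lower bound can only be lost if the
mass escapes, that is if the Fourier transform of `τ_n` is small at the chosen frequencies; on
functions `f` that are nearly constant at scale `1 / P_n` the integrals against `μ` and `m_n` differ
by just this factor (`le_sum_sq_norm_integral_conv`).

The hypothesis on `ρ` prevents this. For a measure `ν` on `[0, 1]`, the restriction of its Fourier
transform to a coset `x + ℤ` is the Fourier series of the image of `exp (-2πi x t) dν(t)` on the
circle, where only the end points `0` and `1` are identified. It can vanish only if these two masses
cancel and nothing else is left, which means `x = 1/2` modulo `1` and `ν = ρ`. The quantitative form is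
`exists_frequently_forall_exists_le_norm_integral_fexp`: for infinitely many `n`, the Fourier
transform of `ν_n` is at least a fixed `ε` somewhere on every coset of `ℤ`. So along these `n` all
frequencies can be moved to places where the transform of `τ_n` is at least `ε`. The frequencies
found at earlier levels need not be moved, as they are small compared with `P_n`, so the frequency
sets increase (`exists_levelFrame_seq`), and their union is a Fourier frame for `μ`
(`exists_fourierFrame`).

For Hadamard triples all upper constants are `1`. A family of unit vectors with upper frame bound
`1` is orthonormal, and a lower frame bound makes it complete, so the frame is an orthonormal basis
(`isSpectrum_of_real_bounds`). For a frame triple tower the constants have convergent products, once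
frequencies that are congruent modulo `N_n` have been merged (`DigitFrame.exists_normalized`).
-/

/-! ### Exponentials -/

/-- The exponential `x ↦ exp (-2πi ξ x)` of frequency `-ξ`, the kernel of the Fourier transform. -/
noncomputable def fexp (ξ x : ℝ) : ℂ := Complex.exp (-2 * Real.pi * Complex.I * ξ * x)

theorem fexp_add_right (ξ x y : ℝ) : fexp ξ (x + y) = fexp ξ x * fexp ξ y := by
  simp only [fexp, ← Complex.exp_add]; push_cast; ring_nf

theorem fexp_add_left (ξ η x : ℝ) : fexp (ξ + η) x = fexp ξ x * fexp η x := by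
  simp only [fexp, ← Complex.exp_add]; push_cast; ring_nf

theorem fexp_eq_exp_mul_I (ξ x : ℝ) :
    fexp ξ x = Complex.exp ((-2 * Real.pi * ξ * x : ℝ) * Complex.I) := by
  rw [fexp]; push_cast; ring_nf

@[simp] theorem norm_fexp (ξ x : ℝ) : ‖fexp ξ x‖ = 1 := by
  rw [fexp_eq_exp_mul_I, Complex.norm_exp_ofReal_mul_I]

theorem continuous_fexp (ξ : ℝ) : Continuous (fexp ξ) := by
  unfold fexp; fun_prop

@[simp] theorem fexp_zero_left (x : ℝ) : fexp 0 x = 1 := by simp [fexp]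

@[simp] theorem fexp_zero_right (ξ : ℝ) : fexp ξ 0 = 1 := by simp [fexp]

theorem fexp_eq_one_of_mul_eq_int {ξ x : ℝ} (z : ℤ) (h : ξ * x = z) : fexp ξ x = 1 := by
  have h' : (ξ : ℂ) * x = z := by exact_mod_cast h
  have : (-2 * Real.pi * Complex.I * ξ * x : ℂ) = (-z : ℤ) * (2 * Real.pi * Complex.I) := by
    push_cast; linear_combination (-2 * Real.pi * Complex.I) * h'
  rw [fexp, this, Complex.exp_int_mul_two_pi_mul_I]

theorem conj_fexp (ξ x : ℝ) :
    (starRingEnd ℂ) (fexp ξ x) = Complex.exp (2 * Real.pi * Complex.I * ξ * x) := by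
  rw [fexp, ← Complex.exp_conj]
  simp [Complex.conj_ofNat]

theorem norm_fexp_sub_fexp_le (ξ η x : ℝ) :
    ‖fexp ξ x - fexp η x‖ ≤ 2 * Real.pi * |ξ - η| * |x| := by
  have e : fexp ξ x - fexp η x
      = fexp η x * (Complex.exp (Complex.I * ((-2 * Real.pi * (ξ - η) * x : ℝ) : ℂ)) - 1) := by
    have : fexp ξ x = fexp η x * fexp (ξ - η) x := by rw [← fexp_add_left]; congr 1; ring
    rw [this, fexp_eq_exp_mul_I (ξ - η), mul_comm Complex.I]; ring
  rw [e, norm_mul, norm_fexp, one_mul]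
  refine Real.norm_exp_I_mul_ofReal_sub_one_le.trans_eq ?_
  rw [Real.norm_eq_abs]
  simp [abs_mul, abs_of_pos Real.pi_pos]

/-! ### The finite convolutions -/

/-- The scale `N_1 ⋯ N_n` of level `n`. -/
def scale (N : ℕ → ℕ) (n : ℕ) : ℕ := ∏ j ∈ Finset.range n, N j

theorem scale_succ (N : ℕ → ℕ) (n : ℕ) : scale N (n + 1) = scale N n * N n :=
  Finset.prod_range_succ _ _

theorem two_pow_le_scale {N : ℕ → ℕ} (hN : ∀ n, 2 ≤ N n) (n : ℕ) : 2 ^ n ≤ scale N n := by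
  induction n with
  | zero => simp [scale]
  | succ n ih => rw [scale_succ, pow_succ]; exact Nat.mul_le_mul ih (hN n)

theorem scale_pos {N : ℕ → ℕ} (hN : ∀ n, 2 ≤ N n) (n : ℕ) : 0 < scale N n :=
  lt_of_lt_of_le (by positivity) (two_pow_le_scale hN n)

theorem conv_sum_dirac {ι : Type*} (m : Measure ℝ) [SFinite m] (s : Finset ι) (g : ι → ℝ) :
    Measure.conv m (∑ i ∈ s, Measure.dirac (g i)) = ∑ i ∈ s, m.map (· + g i) := by
  classical
  induction s using Finset.induction_on with
  | empty => simp
  | insert i s hi ih =>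
    rw [Finset.sum_insert hi, Finset.sum_insert hi, Measure.conv_add, ih, Measure.conv_dirac]

theorem finConv_cantorMoranFactor_succ {N : ℕ → ℕ} (hN : ∀ n, 2 ≤ N n) (B : ℕ → Finset ℤ) (n : ℕ)
    [SFinite (finConv (cantorMoranFactor N B) n)] :
    finConv (cantorMoranFactor N B) (n + 1) = ((B n).card : ENNReal)⁻¹ •
      ∑ b ∈ B n, (finConv (cantorMoranFactor N B) n).map (· + (b : ℝ) / scale N (n + 1)) := by
  have hP : (scale N (n + 1) : ℝ) ≠ 0 := by exact_mod_cast (scale_pos hN (n + 1)).ne'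
  have hs : ∏ j ∈ Finset.range (n + 1), (N j : ℝ) = scale N (n + 1) := by simp [scale]
  have hinj : Function.Injective fun b : ℤ => (b : ℝ) / scale N (n + 1) := by
    intro b b' h
    exact_mod_cast (div_left_inj' hP).1 h
  rw [finConv, cantorMoranFactor, hs, uniformDirac, Finset.card_image_of_injective _ hinj,
    Finset.sum_image hinj.injOn, ← conv_sum_dirac]
  simp [Measure.conv, Measure.prod_smul_right]

section FiniteLevel

variable {N : ℕ → ℕ} {B : ℕ → Finset ℤ}

theorem isProbabilityMeasure_finConv (m : ℕ → Measure ℝ) [∀ k, IsProbabilityMeasure (m k)] (n : ℕ) :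
    IsProbabilityMeasure (finConv m n) := by
  induction n with
  | zero => exact inferInstanceAs (IsProbabilityMeasure (Measure.dirac 0))
  | succ n ih => exact inferInstanceAs (IsProbabilityMeasure (Measure.conv _ _))

theorem isProbabilityMeasure_finConv_cantorMoranFactor (hne : ∀ n, (B n).Nonempty) (n : ℕ) :
    IsProbabilityMeasure (finConv (cantorMoranFactor N B) n) := by
  have : ∀ k, IsProbabilityMeasure (cantorMoranFactor N B k) := fun k =>
    uniformDirac_isProbabilityMeasure ((hne k).image _)
  exact isProbabilityMeasure_finConv _ n

/-- The finite convolutions are finitely supported, so every function is integrable. -/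
theorem integrable_finConv_cantorMoranFactor {E : Type*} [NormedAddCommGroup E]
    (hN : ∀ n, 2 ≤ N n) (hne : ∀ n, (B n).Nonempty) (n : ℕ)
    (f : ℝ → E) : Integrable f (finConv (cantorMoranFactor N B) n) := by
  have := isProbabilityMeasure_finConv_cantorMoranFactor (N := N) hne
  induction n generalizing f with
  | zero => exact integrable_dirac (by simp)
  | succ n ih =>
    rw [finConv_cantorMoranFactor_succ hN]
    refine Integrable.smul_measure ?_ (by simpa using (hne n).ne_empty)
    refine integrable_finsetSum_measure.2 fun b _ => ?_
    exact ((MeasurableEquiv.addRight ((b : ℝ) / scale N (n + 1))).measurableEmbedding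
      |>.integrable_map_iff).2 (ih _)

theorem integral_finConv_cantorMoranFactor_succ {E : Type*} [NormedAddCommGroup E]
    [NormedSpace ℝ E] (hN : ∀ n, 2 ≤ N n)
    (hne : ∀ n, (B n).Nonempty) (n : ℕ) (f : ℝ → E) :
    ∫ x, f x ∂(finConv (cantorMoranFactor N B) (n + 1)) = ((B n).card : ℝ)⁻¹ •
      ∑ b ∈ B n, ∫ x, f (x + (b : ℝ) / scale N (n + 1)) ∂(finConv (cantorMoranFactor N B) n) := by
  have := isProbabilityMeasure_finConv_cantorMoranFactor (N := N) hne
  have hmap : ∀ b : ℤ, MeasurableEmbedding fun x : ℝ => x + (b : ℝ) / scale N (n + 1) := fun b =>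
    (MeasurableEquiv.addRight ((b : ℝ) / scale N (n + 1))).measurableEmbedding
  rw [finConv_cantorMoranFactor_succ hN, integral_smul_measure, integral_finsetSum_measure]
  · rw [ENNReal.toReal_inv, ENNReal.toReal_natCast]
    exact congrArg _ (Finset.sum_congr rfl fun b _ => (hmap b).integral_map f)
  · exact fun b _ => (hmap b).integrable_map_iff.2
      (integrable_finConv_cantorMoranFactor hN hne n _)

/-- The finite convolution of level `n` is carried by `(N_1 ⋯ N_n)⁻¹ ℤ`. -/
theorem ae_finConv_cantorMoranFactor_scale_mul_eq_int (hN : ∀ n, 2 ≤ N n)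
    (hne : ∀ n, (B n).Nonempty) (n : ℕ) :
    ∀ᵐ x ∂(finConv (cantorMoranFactor N B) n), ∃ z : ℤ, (scale N n : ℝ) * x = z := by
  have := isProbabilityMeasure_finConv_cantorMoranFactor (N := N) hne
  induction n with
  | zero =>
    rw [finConv, ae_dirac_eq]
    exact ⟨0, by simp⟩
  | succ n ih =>
    have hP : (scale N (n + 1) : ℝ) ≠ 0 := by exact_mod_cast (scale_pos hN (n + 1)).ne'
    rw [finConv_cantorMoranFactor_succ hN]
    refine Measure.ae_smul_measure ?_ _
    rw [← Measure.sum_coe_finset, Measure.ae_sum_iff]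
    rintro ⟨b, hb⟩
    rw [(MeasurableEquiv.addRight ((b : ℝ) / scale N (n + 1))).measurableEmbedding.ae_map_iff
      (f := fun x => x + (b : ℝ) / scale N (n + 1))]
    filter_upwards [ih] with x hx
    obtain ⟨z, hz⟩ := hx
    refine ⟨z * N n + b, ?_⟩
    rw [mul_add, mul_div_cancel₀ _ hP, scale_succ]
    push_cast
    rw [← hz]; ring

end FiniteLevel

/-! ### Fourier frames of the finite convolutions -/

/-- Frame bounds `a`, `c` for the map `w ↦ ((1/√#B) ∑_b exp (-2πi b l / N) w_b)_{l ∈ L}`, with the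
factor `1/√#B` taken out of the squared norms. -/
structure DigitFrame (N : ℕ) (B L : Finset ℤ) (a c : ℝ) : Prop where
  lower : ∀ w : ℤ → ℂ, a * ∑ b ∈ B, ‖w b‖ ^ 2 ≤
    (B.card : ℝ)⁻¹ * ∑ l ∈ L, ‖∑ b ∈ B, fexp l (b / N) * w b‖ ^ 2
  upper : ∀ w : ℤ → ℂ, (B.card : ℝ)⁻¹ * ∑ l ∈ L, ‖∑ b ∈ B, fexp l (b / N) * w b‖ ^ 2 ≤
    c * ∑ b ∈ B, ‖w b‖ ^ 2

/-- The integer frequencies `Λ` are pairwise incongruent modulo `N_1 ⋯ N_n` and form a Fourier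
frame with bounds `a`, `c` for the finite convolution of level `n`. -/
structure LevelFrame (N : ℕ → ℕ) (B : ℕ → Finset ℤ) (n : ℕ) (Λ : Finset ℤ) (a c : ℝ) : Prop where
  inj : ∀ k ∈ Λ, ∀ k' ∈ Λ, (scale N n : ℤ) ∣ k - k' → k = k'
  lower : ∀ f : ℝ → ℂ, a * ∫ x, ‖f x‖ ^ 2 ∂(finConv (cantorMoranFactor N B) n) ≤
    ∑ k ∈ Λ, ‖∫ x, f x * fexp k x ∂(finConv (cantorMoranFactor N B) n)‖ ^ 2
  upper : ∀ f : ℝ → ℂ, ∑ k ∈ Λ, ‖∫ x, f x * fexp k x ∂(finConv (cantorMoranFactor N B) n)‖ ^ 2 ≤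
    c * ∫ x, ‖f x‖ ^ 2 ∂(finConv (cantorMoranFactor N B) n)

section LevelFrame

variable {N : ℕ → ℕ} {B : ℕ → Finset ℤ}

theorem levelFrame_zero : LevelFrame N B 0 {0} 1 1 := by
  constructor <;> simp [finConv]

/-- Frequencies of a level frame matter only modulo `N_1 ⋯ N_n`. -/
theorem LevelFrame.image_add_scale_mul (hN : ∀ n, 2 ≤ N n) (hne : ∀ n, (B n).Nonempty) {n : ℕ}
    {Λ : Finset ℤ} {a c : ℝ} (h : LevelFrame N B n Λ a c) (κ : ℤ → ℤ) :
    LevelFrame N B n (Λ.image fun k => k + scale N n * κ k) a c := by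
  have hinj : ∀ k ∈ Λ, ∀ k' ∈ Λ,
      (scale N n : ℤ) ∣ (k + scale N n * κ k) - (k' + scale N n * κ k') → k = k' := by
    intro k hk k' hk' hd
    refine h.inj k hk k' hk' ?_
    obtain ⟨t, ht⟩ := hd
    exact ⟨t - κ k + κ k', by linear_combination ht⟩
  have hsum : ∀ f : ℝ → ℂ, ∑ k ∈ (Λ.image fun k => k + scale N n * κ k : Finset ℤ),
      ‖∫ x, f x * fexp k x ∂(finConv (cantorMoranFactor N B) n)‖ ^ 2
      = ∑ k ∈ Λ, ‖∫ x, f x * fexp k x ∂(finConv (cantorMoranFactor N B) n)‖ ^ 2 := by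
    intro f
    rw [Finset.sum_image fun k hk k' hk' e => hinj k hk k' hk' (by simp [e])]
    refine Finset.sum_congr rfl fun k _ => ?_
    congr 2
    refine integral_congr_ae ?_
    filter_upwards [ae_finConv_cantorMoranFactor_scale_mul_eq_int hN hne n] with x hx
    obtain ⟨z, hz⟩ := hx
    push_cast
    rw [fexp_add_left, fexp_eq_one_of_mul_eq_int (ξ := scale N n * κ k) (κ k * z) (by
      push_cast; rw [← hz]; ring), mul_one]
  refine ⟨?_, fun f => by rw [hsum]; exact h.lower f, fun f => by rw [hsum]; exact h.upper f⟩
  simp only [Finset.mem_image]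
  rintro _ ⟨k, hk, rfl⟩ _ ⟨k', hk', rfl⟩ hd
  rw [hinj k hk k' hk' hd]

theorem integral_mul_fexp_finConv_succ (hN : ∀ n, 2 ≤ N n) (hne : ∀ n, (B n).Nonempty) (n : ℕ)
    (f : ℝ → ℂ) (k l : ℤ) :
    ∫ x, f x * fexp (k + scale N n * l : ℤ) x ∂(finConv (cantorMoranFactor N B) (n + 1)) =
      ((B n).card : ℝ)⁻¹ • ∑ b ∈ B n, fexp l (b / N n) * (fexp k (b / scale N (n + 1)) *
        ∫ x, f (x + (b : ℝ) / scale N (n + 1)) * fexp k x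
          ∂(finConv (cantorMoranFactor N B) n)) := by
  have hP : (scale N n : ℝ) ≠ 0 := by exact_mod_cast (scale_pos hN n).ne'
  have hNn : (N n : ℝ) ≠ 0 := by have := hN n; positivity
  rw [integral_finConv_cantorMoranFactor_succ hN hne]
  congr 1
  refine Finset.sum_congr rfl fun b _ => ?_
  rw [← mul_assoc, ← integral_const_mul]
  refine integral_congr_ae ?_
  filter_upwards [ae_finConv_cantorMoranFactor_scale_mul_eq_int hN hne n] with x hx
  obtain ⟨z, hz⟩ := hx
  have e1 : fexp (scale N n * l : ℝ) x = 1 :=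
    fexp_eq_one_of_mul_eq_int (l * z) (by push_cast; rw [← hz]; ring)
  have e2 : fexp (scale N n * l : ℝ) ((b : ℝ) / scale N (n + 1)) = fexp l (b / N n) := by
    have : ((scale N n : ℝ) : ℂ) ≠ 0 := by exact_mod_cast hP
    have : (N n : ℂ) ≠ 0 := by exact_mod_cast hNn
    rw [fexp, fexp, scale_succ]
    congr 1
    push_cast at *
    field_simp
  push_cast
  rw [fexp_add_left, fexp_add_right, fexp_add_right _ x, e1, e2]
  ring

/-- Composition of a level frame with a digit frame: for fixed `k`, summing over `l` uses the digit
frame on the vector indexed by the last digit `b`; then, for fixed `b`, summing over `k` uses the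
level frame on a translate of `f`. -/
theorem LevelFrame.succ (hN : ∀ n, 2 ≤ N n) (hne : ∀ n, (B n).Nonempty) {n : ℕ}
    {Λ L : Finset ℤ} {a c a' c' : ℝ} (h : LevelFrame N B n Λ a c)
    (h' : DigitFrame (N n) (B n) L a' c') (ha' : 0 ≤ a') (hc' : 0 ≤ c')
    (hL : ∀ l ∈ L, ∀ l' ∈ L, (N n : ℤ) ∣ l - l' → l = l') :
    LevelFrame N B (n + 1) ((Λ ×ˢ L).image fun p => p.1 + scale N n * p.2) (a * a') (c * c') := by
  have hP : (scale N n : ℤ) ≠ 0 := by exact_mod_cast (scale_pos hN n).ne'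
  have hinj : ∀ p ∈ Λ ×ˢ L, ∀ p' ∈ Λ ×ˢ L,
      (scale N (n + 1) : ℤ) ∣ (p.1 + scale N n * p.2) - (p'.1 + scale N n * p'.2) → p = p' := by
    rintro ⟨k, l⟩ hp ⟨k', l'⟩ hp' hd
    simp only [Finset.mem_product] at hp hp' hd
    rw [scale_succ] at hd
    push_cast at hd
    have h1 : k = k' := by
      refine h.inj k hp.1 k' hp'.1 ?_
      obtain ⟨t, ht⟩ := hd
      exact ⟨N n * t - l + l', by linear_combination ht⟩
    have h2 : l = l' := by
      refine hL l hp.2 l' hp'.2 ?_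
      obtain ⟨t, ht⟩ := hd
      refine ⟨t, mul_left_cancel₀ hP ?_⟩
      rw [h1] at ht
      linear_combination ht
    rw [h1, h2]
  have hM : (0 : ℝ) < (B n).card := by exact_mod_cast (hne n).card_pos
  set m := finConv (cantorMoranFactor N B) n with hm
  set w : (ℝ → ℂ) → ℤ → ℤ → ℂ := fun f k b => fexp k (b / scale N (n + 1)) *
    ∫ x, f (x + (b : ℝ) / scale N (n + 1)) * fexp k x ∂m with hw
  have hsum : ∀ f : ℝ → ℂ, ∑ k ∈ ((Λ ×ˢ L).image fun p => p.1 + scale N n * p.2 : Finset ℤ),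
      ‖∫ x, f x * fexp k x ∂(finConv (cantorMoranFactor N B) (n + 1))‖ ^ 2
      = ((B n).card : ℝ)⁻¹ * ∑ k ∈ Λ, (((B n).card : ℝ)⁻¹ *
        ∑ l ∈ L, ‖∑ b ∈ B n, fexp l (b / N n) * w f k b‖ ^ 2) := by
    intro f
    rw [Finset.sum_image fun k hk k' hk' e => hinj k hk k' hk' (by simp [e]),
      Finset.sum_product, Finset.mul_sum]
    refine Finset.sum_congr rfl fun k _ => ?_
    rw [← mul_assoc, Finset.mul_sum]
    refine Finset.sum_congr rfl fun l _ => ?_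
    rw [integral_mul_fexp_finConv_succ hN hne, norm_smul, mul_pow, Real.norm_of_nonneg (by positivity),
      sq (_⁻¹)]
  have hnw : ∀ f : ℝ → ℂ, ∑ k ∈ Λ, ∑ b ∈ B n, ‖w f k b‖ ^ 2 = ∑ b ∈ B n, ∑ k ∈ Λ,
      ‖∫ x, f (x + (b : ℝ) / scale N (n + 1)) * fexp k x ∂m‖ ^ 2 := by
    intro f
    rw [Finset.sum_comm]
    simp [hw]
  have hint : ∀ f : ℝ → ℂ, ∫ x, ‖f x‖ ^ 2 ∂(finConv (cantorMoranFactor N B) (n + 1)) =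
      ((B n).card : ℝ)⁻¹ * ∑ b ∈ B n, ∫ x, ‖f (x + (b : ℝ) / scale N (n + 1))‖ ^ 2 ∂m := by
    intro f
    rw [integral_finConv_cantorMoranFactor_succ hN hne, smul_eq_mul]
  refine ⟨?_, fun f => ?_, fun f => ?_⟩
  · simp only [Finset.mem_image]
    rintro _ ⟨p, hp, rfl⟩ _ ⟨p', hp', rfl⟩ hd
    rw [hinj p hp p' hp' hd]
  · rw [hsum, hint]
    calc a * a' * (((B n).card : ℝ)⁻¹ * ∑ b ∈ B n, ∫ x, ‖f (x + (b : ℝ) / scale N (n + 1))‖ ^ 2 ∂m)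
        = ((B n).card : ℝ)⁻¹ * (a' * ∑ b ∈ B n,
          a * ∫ x, ‖f (x + (b : ℝ) / scale N (n + 1))‖ ^ 2 ∂m) := by
          rw [← Finset.mul_sum]; ring
      _ ≤ ((B n).card : ℝ)⁻¹ * (a' * ∑ k ∈ Λ, ∑ b ∈ B n, ‖w f k b‖ ^ 2) := by
          rw [hnw]
          gcongr with b
          exact h.lower _
      _ ≤ _ := by
          rw [Finset.mul_sum Λ _ a']
          exact mul_le_mul_of_nonneg_left (Finset.sum_le_sum fun k _ => h'.lower _)
            (by positivity)
  · rw [hsum, hint]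
    calc _ ≤ ((B n).card : ℝ)⁻¹ * (c' * ∑ k ∈ Λ, ∑ b ∈ B n, ‖w f k b‖ ^ 2) := by
          rw [Finset.mul_sum Λ _ c']
          exact mul_le_mul_of_nonneg_left (Finset.sum_le_sum fun k _ => h'.upper _)
            (by positivity)
      _ ≤ ((B n).card : ℝ)⁻¹ * (c' * ∑ b ∈ B n,
          c * ∫ x, ‖f (x + (b : ℝ) / scale N (n + 1))‖ ^ 2 ∂m) := by
          rw [hnw]
          gcongr with b
          exact h.upper _
      _ = _ := by
          rw [← Finset.mul_sum]; ring

/-- A level frame extends to every later level, for digit frames whose frequency sets contain `0`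
and are incongruent modulo the respective `N_n`. -/
theorem LevelFrame.exists_of_le (hN : ∀ n, 2 ≤ N n) (hne : ∀ n, (B n).Nonempty) {L : ℕ → Finset ℤ}
    {a c : ℕ → ℝ} (ha : ∀ n, 0 ≤ a n) (hc : ∀ n, 0 ≤ c n)
    (hF : ∀ n, DigitFrame (N n) (B n) (L n) (a n) (c n)) (h0 : ∀ n, 0 ∈ L n)
    (hL : ∀ n, ∀ l ∈ L n, ∀ l' ∈ L n, (N n : ℤ) ∣ l - l' → l = l') {n n' : ℕ} (hn : n ≤ n')
    {Λ : Finset ℤ} (h : LevelFrame N B n Λ (∏ k ∈ Finset.range n, a k)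
      (∏ k ∈ Finset.range n, c k)) :
    ∃ Λ', Λ ⊆ Λ' ∧ LevelFrame N B n' Λ' (∏ k ∈ Finset.range n', a k)
      (∏ k ∈ Finset.range n', c k) := by
  induction n', hn using Nat.le_induction with
  | base => exact ⟨Λ, subset_rfl, h⟩
  | succ j _ ih =>
    obtain ⟨Λ', hs, h'⟩ := ih
    refine ⟨_, fun k hk => ?_, by
      rw [Finset.prod_range_succ, Finset.prod_range_succ]
      exact h'.succ hN hne (hF j) (ha j) (hc j) (hL j)⟩
    exact Finset.mem_image.2 ⟨(k, 0), by simp [hs hk, h0 j], by simp⟩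

end LevelFrame

/-! ### Fourier transforms of measures on the unit interval -/

theorem integrable_fexp (ν : Measure ℝ) [IsFiniteMeasure ν] (ξ : ℝ) : Integrable (fexp ξ) ν :=
  Integrable.of_bound (continuous_fexp ξ).aestronglyMeasurable 1 (ae_of_all _ fun x => by simp)

/-- A measure on `[0, 1]` has a Fourier transform bounded away from `0` near `0`: after a
translation by `1/2`, the real part of the integrand is at least `cos (π y)`. -/
theorem one_sub_two_mul_abs_le_norm_integral_fexp {ν : Measure ℝ} [IsProbabilityMeasure ν]
    (hν : ∀ᵐ x ∂ν, x ∈ Set.Icc (0 : ℝ) 1) {y : ℝ} (hy : |y| ≤ 1 / 2) :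
    1 - 2 * |y| ≤ ‖∫ x, fexp y x ∂ν‖ := by
  have hi : Integrable (fun x => fexp y (x - 1 / 2)) ν :=
    Integrable.of_bound ((continuous_fexp y).comp (by fun_prop)).aestronglyMeasurable 1
      (ae_of_all _ fun x => by simp)
  have e : ∫ x, fexp y x ∂ν = fexp y (1 / 2) * ∫ x, fexp y (x - 1 / 2) ∂ν := by
    rw [← integral_const_mul]
    congr 1
    ext x
    rw [← fexp_add_right]; congr 1; ring
  rw [e, norm_mul, norm_fexp, one_mul]
  refine le_trans ?_ (Complex.re_le_norm _)
  have hre : (∫ x, fexp y (x - 1 / 2) ∂ν).re = ∫ x, (fexp y (x - 1 / 2)).re ∂ν :=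
    (integral_re hi).symm
  have h1 : 1 - 2 * |y| = ∫ _, (1 - 2 * |y|) ∂ν := by simp
  rw [hre, h1]
  refine integral_mono_ae (integrable_const _) hi.re ?_
  filter_upwards [hν] with x hx
  change _ ≤ (fexp y (x - 1 / 2)).re
  rw [fexp_eq_exp_mul_I, Complex.exp_ofReal_mul_I_re, ← Real.cos_abs]
  have hπ := Real.pi_pos
  have hxa : |x - 1 / 2| ≤ 1 / 2 := by rw [abs_le]; constructor <;> linarith [hx.1, hx.2]
  have hθ : |-2 * Real.pi * y * (x - 1 / 2)| ≤ Real.pi * |y| := by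
    rw [abs_mul, abs_mul, abs_mul, abs_of_pos hπ]
    have : |(-2 : ℝ)| = 2 := by norm_num
    rw [this]
    nlinarith [mul_nonneg hπ.le (abs_nonneg y)]
  have hc := Real.one_sub_mul_le_cos (abs_nonneg (-2 * Real.pi * y * (x - 1 / 2)))
    (by nlinarith)
  refine le_trans ?_ hc
  have : 2 / Real.pi * |-2 * Real.pi * y * (x - 1 / 2)| ≤ 2 / Real.pi * (Real.pi * |y|) := by
    gcongr
  have e2 : 2 / Real.pi * (Real.pi * |y|) = 2 * |y| := by field_simp
  linarith

theorem norm_integral_fexp_sub_le {ν : Measure ℝ} [IsProbabilityMeasure ν]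
    (hν : ∀ᵐ x ∂ν, x ∈ Set.Icc (0 : ℝ) 1) (ξ η : ℝ) :
    ‖∫ x, fexp ξ x ∂ν - ∫ x, fexp η x ∂ν‖ ≤ 2 * Real.pi * |ξ - η| := by
  rw [← integral_sub (integrable_fexp ν ξ) (integrable_fexp ν η)]
  have := norm_integral_le_of_norm_le_const (μ := ν) (C := 2 * Real.pi * |ξ - η|)
    (f := fun x => fexp ξ x - fexp η x) (by
      filter_upwards [hν] with x hx
      refine (norm_fexp_sub_fexp_le _ _ _).trans ?_
      have : |x| ≤ 1 := by rw [abs_le]; constructor <;> linarith [hx.1, hx.2]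
      exact mul_le_of_le_one_right (by positivity) this)
  simpa using this

/-- If the Fourier transform of a measure on `[0, 1]` is small on a coset of `ℤ`, then this coset is
close to `1/2 + ℤ`, hence the Fourier transform is small at all half-integers. -/
theorem norm_integral_fexp_half_add_int_le {ν : Measure ℝ} [IsProbabilityMeasure ν]
    (hν : ∀ᵐ x ∂ν, x ∈ Set.Icc (0 : ℝ) 1) {ε x : ℝ}
    (hx : ∀ k : ℤ, ‖∫ t, fexp (x + k) t ∂ν‖ < ε) (k : ℤ) :
    ‖∫ t, fexp (1 / 2 + k) t ∂ν‖ ≤ 5 * ε := by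
  have h0 := Int.fract_nonneg x
  have h1 := (Int.fract_lt_one x).le
  set y := Int.fract x with hy
  have hxy : ∀ k : ℤ, ‖∫ t, fexp (y + k) t ∂ν‖ < ε := by
    intro k
    have := hx (k - ⌊x⌋)
    have e : x + ((k - ⌊x⌋ : ℤ) : ℝ) = y + k := by rw [hy, Int.fract]; push_cast; ring
    rwa [e] at this
  -- Compare `y` or `y - 1`, whichever is closer to `0`, with the lower bound near `0`.
  have hd : 2 * |1 / 2 - y| ≤ ε := by
    rcases le_total y (1 / 2) with h | h
    · have a := one_sub_two_mul_abs_le_norm_integral_fexp hν (y := y) (by rwa [abs_of_nonneg h0])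
      have b := hxy 0
      rw [abs_of_nonneg h0] at a
      simp only [Int.cast_zero, add_zero] at b
      rw [abs_of_nonneg (by linarith)]
      linarith
    · have a := one_sub_two_mul_abs_le_norm_integral_fexp hν (y := y + (-1 : ℤ)) (by
        rw [abs_le]; push_cast; constructor <;> linarith)
      have b := hxy (-1)
      rw [abs_of_nonpos (by push_cast; linarith)] at a
      rw [abs_of_nonpos (by linarith)]
      push_cast at a b
      linarith
  have hε : 0 < ε := (norm_nonneg _).trans_lt (hxy 0)
  have hs := norm_integral_fexp_sub_le hν (1 / 2 + k) (y + k)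
  have e : |(1 / 2 + k : ℝ) - (y + k)| = |1 / 2 - y| := by congr 1; ring
  rw [e] at hs
  have hπ := Real.pi_lt_four
  have : 2 * Real.pi * |1 / 2 - y| ≤ 4 * ε := by
    nlinarith [mul_nonneg (by linarith : (0:ℝ) ≤ 4 - Real.pi) (abs_nonneg (1 / 2 - y))]
  calc _ ≤ ‖∫ x, fexp (1 / 2 + k) x ∂ν - ∫ x, fexp (y + k) x ∂ν‖ + ‖∫ x, fexp (y + k) x ∂ν‖ := by
        simpa using norm_add_le (∫ x, fexp (1 / 2 + k) x ∂ν - ∫ x, fexp (y + k) x ∂ν)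
          (∫ x, fexp (y + k) x ∂ν)
    _ ≤ _ := by linarith [hxy k]

theorem integrable_circle_mul_fexp (ν : Measure ℝ) [IsFiniteMeasure ν] (p : C(AddCircle (1 : ℝ), ℂ))
    (ξ : ℝ) : Integrable (fun x : ℝ => p x * fexp ξ x) ν := by
  refine Integrable.of_bound (Continuous.aestronglyMeasurable ?_) ‖p‖ (ae_of_all _ fun x => ?_)
  · exact (p.continuous.comp (AddCircle.continuous_mk' 1)).mul (continuous_fexp ξ)
  · simpa using p.norm_coe_le_norm x

/-- Vanishing of the limits at half-integers passes from the characters of `ℝ/ℤ` to all continuous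
functions on `ℝ/ℤ` by density of trigonometric polynomials. -/
theorem tendsto_integral_circle_mul_fexp_half {ν : ℕ → Measure ℝ} [∀ n, IsProbabilityMeasure (ν n)]
    (h : ∀ k : ℤ, Tendsto (fun n => ∫ x, fexp (1 / 2 + k) x ∂(ν n)) atTop (𝓝 0))
    (p : C(AddCircle (1 : ℝ), ℂ)) :
    Tendsto (fun n => ∫ x : ℝ, p x * fexp (1 / 2) x ∂(ν n)) atTop (𝓝 0) := by
  have hspan : ∀ q ∈ Submodule.span ℂ (Set.range (@fourier (1 : ℝ))),
      Tendsto (fun n => ∫ x : ℝ, q x * fexp (1 / 2) x ∂(ν n)) atTop (𝓝 0) := by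
    intro q hq
    induction hq using Submodule.span_induction with
    | mem q hq =>
      obtain ⟨k, rfl⟩ := hq
      refine (h (-k)).congr fun n => ?_
      congr 1
      ext x
      rw [fourier_coe_apply, add_comm, fexp_add_left]
      congr 1
      rw [fexp]
      congr 1
      push_cast
      ring
    | zero => simp
    | add q r _ _ hq hr =>
      simpa [add_mul, integral_add (integrable_circle_mul_fexp _ q _)
        (integrable_circle_mul_fexp _ r _)] using hq.add hr
    | smul a q _ hq =>
      simpa [mul_assoc, integral_const_mul] using hq.const_mul a
  rw [Metric.tendsto_atTop]
  intro ε hε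
  have hp : p ∈ (Submodule.span ℂ (Set.range (@fourier (1 : ℝ)))).topologicalClosure := by
    rw [span_fourier_closure_eq_top]; trivial
  obtain ⟨q, hq, hpq⟩ := Metric.mem_closure_iff.1 hp (ε / 2) (by positivity)
  obtain ⟨n₀, hn₀⟩ := Metric.tendsto_atTop.1 (hspan q hq) (ε / 2) (by positivity)
  refine ⟨n₀, fun n hn => ?_⟩
  have h1 := hn₀ n hn
  rw [dist_zero_right] at h1 ⊢
  have h2 : ‖∫ x : ℝ, p x * fexp (1 / 2) x ∂(ν n) - ∫ x : ℝ, q x * fexp (1 / 2) x ∂(ν n)‖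
      ≤ ‖p - q‖ := by
    rw [← integral_sub (integrable_circle_mul_fexp _ p _) (integrable_circle_mul_fexp _ q _)]
    have := norm_integral_le_of_norm_le_const (μ := ν n) (C := ‖p - q‖)
      (f := fun x : ℝ => p x * fexp (1 / 2) x - q x * fexp (1 / 2) x)
      (ae_of_all _ fun x => by
        rw [← sub_mul, norm_mul, norm_fexp, mul_one]
        exact (p - q).norm_coe_le_norm x)
    simpa using this
  rw [dist_eq_norm] at hpq
  calc _ ≤ ‖∫ x : ℝ, p x * fexp (1 / 2) x ∂(ν n) - ∫ x : ℝ, q x * fexp (1 / 2) x ∂(ν n)‖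
        + ‖∫ x : ℝ, q x * fexp (1 / 2) x ∂(ν n)‖ := by
        simpa using norm_add_le (∫ x : ℝ, p x * fexp (1 / 2) x ∂(ν n)
          - ∫ x : ℝ, q x * fexp (1 / 2) x ∂(ν n)) (∫ x : ℝ, q x * fexp (1 / 2) x ∂(ν n))
    _ < ε := by linarith

/-- Measures on `[0, 1]` whose Fourier transforms tend to `0` at all half-integers converge weakly
to `ρ`: every continuous function is, on `[0, 1]`, the sum of its `ρ`-integral and of a function `G`
with `G 1 = -G 0`, and such a `G` is a continuous function on `ℝ/ℤ` times `exp (-πi x)`. -/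
theorem weaklyConverges_rhoMeasure {ν : ℕ → Measure ℝ} [∀ n, IsProbabilityMeasure (ν n)]
    (hν : ∀ n, ∀ᵐ x ∂(ν n), x ∈ Set.Icc (0 : ℝ) 1)
    (h : ∀ k : ℤ, Tendsto (fun n => ∫ x, fexp (1 / 2 + k) x ∂(ν n)) atTop (𝓝 0)) :
    WeaklyConverges ν rhoMeasure := by
  intro g
  set c : ℝ := (g 0 + g 1) / 2 with hc
  have hρ : ∫ x, g x ∂rhoMeasure = c := by
    rw [rhoMeasure, integral_smul_measure, integral_add_measure (integrable_dirac (by simp))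
      (integrable_dirac (by simp)), integral_dirac, integral_dirac]
    simp [hc]; ring
  set G : ℝ → ℂ := fun x => ((g x - c : ℝ) : ℂ) * fexp (-(1 / 2)) x with hG
  have hGc : Continuous G :=
    (Complex.continuous_ofReal.comp (g.continuous.sub continuous_const)).mul (continuous_fexp _)
  have hf1 : fexp (-(1 / 2)) 1 = -1 := by
    rw [fexp, ← Complex.exp_pi_mul_I]; congr 1; push_cast; ring
  have hG01 : G 0 = G 1 := by
    simp only [hG, hf1, fexp_zero_right]
    have : g 0 - c = -(g 1 - c) := by rw [hc]; ring
    rw [this]; push_cast; ring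
  set p : C(AddCircle (1 : ℝ), ℂ) :=
    ⟨AddCircle.liftIco 1 0 G, AddCircle.liftIco_zero_continuous hG01 hGc.continuousOn⟩ with hp
  have hpG : ∀ x ∈ Set.Icc (0 : ℝ) 1, p x = G x := by
    intro x hx
    rcases hx.2.lt_or_eq with h1 | rfl
    · exact AddCircle.liftIco_zero_coe_apply (p := (1 : ℝ)) (f := G) ⟨hx.1, h1⟩
    · have : ((1 : ℝ) : AddCircle (1 : ℝ)) = ((0 : ℝ) : AddCircle (1 : ℝ)) := by
        simp
      rw [this, ← hG01]
      exact AddCircle.liftIco_zero_coe_apply (p := (1 : ℝ)) (f := G) ⟨le_rfl, one_pos⟩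
  have key : ∀ n, ∫ x : ℝ, p x * fexp (1 / 2) x ∂(ν n) = ((∫ x, g x ∂(ν n) - c : ℝ) : ℂ) := by
    intro n
    have e : ∫ x, g x ∂(ν n) - c = ∫ x, (g x - c) ∂(ν n) := by
      rw [integral_sub (g.integrable _) (integrable_const _)]; simp
    rw [e, ← integral_complex_ofReal]
    refine integral_congr_ae ?_
    filter_upwards [hν n] with x hx
    rw [hpG x hx, hG]
    change _ * fexp (-(1 / 2)) x * _ = _
    rw [mul_assoc, ← fexp_add_left]
    simp
  have hlim := tendsto_integral_circle_mul_fexp_half h p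
  simp_rw [key] at hlim
  have hlim' : Tendsto (fun n => ∫ x, g x ∂(ν n) - c) atTop (𝓝 0) := by
    have := (Complex.continuous_re.tendsto _).comp hlim
    simpa [Function.comp_def] using this
  rw [hρ]
  simpa using hlim'.add_const c

/-- If probability measures on `[0, 1]` do not converge weakly to `ρ`, then infinitely many of their
Fourier transforms are bounded below, by a common constant, somewhere on every coset of `ℤ`. -/
theorem exists_frequently_forall_exists_le_norm_integral_fexp {ν : ℕ → Measure ℝ}
    [∀ n, IsProbabilityMeasure (ν n)] (hν : ∀ n, ∀ᵐ x ∂(ν n), x ∈ Set.Icc (0 : ℝ) 1)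
    (h : ¬ WeaklyConverges ν rhoMeasure) :
    ∃ ε > 0, ∃ᶠ n in atTop, ∀ x : ℝ, ∃ k : ℤ, ε ≤ ‖∫ t, fexp (x + k) t ∂(ν n)‖ := by
  by_contra! hcon
  refine h (weaklyConverges_rhoMeasure hν fun k => ?_)
  rw [Metric.tendsto_nhds]
  intro ε hε
  have := hcon (ε / 6) (by positivity)
  filter_upwards [this] with n hn
  obtain ⟨x, hx⟩ := hn
  rw [dist_zero_right]
  linarith [norm_integral_fexp_half_add_int_le (hν n) hx k]

/-! ### Fourier frames of convolutions -/

theorem sq_norm_integral_le {α : Type*} [MeasurableSpace α] {τ : Measure α} [IsProbabilityMeasure τ]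
    {g : α → ℂ} (hg : AEStronglyMeasurable g τ) (h2 : Integrable (fun x => ‖g x‖ ^ 2) τ) :
    ‖∫ x, g x ∂τ‖ ^ 2 ≤ ∫ x, ‖g x‖ ^ 2 ∂τ := by
  have hL : MemLp g 2 τ := (memLp_two_iff_integrable_sq_norm hg).2 h2
  have h1 : Integrable (fun x => ‖g x‖) τ := (hL.integrable (by norm_num)).norm
  set c := ∫ x, ‖g x‖ ∂τ with hc
  have h0 : 0 ≤ ∫ x, (‖g x‖ - c) ^ 2 ∂τ := integral_nonneg fun x => sq_nonneg _
  have e : ∫ x, (‖g x‖ - c) ^ 2 ∂τ = ∫ x, ‖g x‖ ^ 2 ∂τ - c ^ 2 := by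
    have : ∀ x, (‖g x‖ - c) ^ 2 = ‖g x‖ ^ 2 - (2 * c * ‖g x‖ - c ^ 2) := fun x => by ring
    simp_rw [this]
    have hi : Integrable (fun x => 2 * c * ‖g x‖ - c ^ 2) τ :=
      (h1.const_mul _).sub (integrable_const _)
    rw [integral_sub h2 hi,
      integral_sub (h1.const_mul _) (integrable_const _), integral_const_mul, ← hc]
    simp; ring
  have h3 : ‖∫ x, g x ∂τ‖ ≤ c := norm_integral_le_integral_norm _
  have h4 : ‖∫ x, g x ∂τ‖ ^ 2 ≤ c ^ 2 := by gcongr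
  linarith

theorem MeasureTheory.MemLp.integrable_mul_fexp {α : Type*} [MeasurableSpace α] {P : Measure α}
    [IsFiniteMeasure P] {h : α → ℂ} (hh : MemLp h 2 P) {u : α → ℝ} (hu : Measurable u) (ξ : ℝ) :
    Integrable (fun z => h z * fexp ξ (u z)) P :=
  (hh.integrable (by norm_num)).mul_bdd (c := 1)
    ((continuous_fexp ξ).measurable.comp hu).aestronglyMeasurable (ae_of_all _ fun z => by simp)

section Conv

variable {m τ : Measure ℝ} [IsProbabilityMeasure m] [IsProbabilityMeasure τ] {Λ : Finset ℤ}
  {a c : ℝ}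

/-- An upper frame bound for `m` is inherited by functions of two variables on `m ⊗ τ`: apply it to
the sections `h(·, t)` and integrate over `t`. -/
theorem sum_sq_norm_integral_prod_le
    (hup : ∀ f : ℝ → ℂ, ∑ k ∈ Λ, ‖∫ x, f x * fexp k x ∂m‖ ^ 2 ≤ c * ∫ x, ‖f x‖ ^ 2 ∂m)
    {h : ℝ × ℝ → ℂ} (hh : MemLp h 2 (m.prod τ)) :
    ∑ k ∈ Λ, ‖∫ z, h z * fexp k (z.1 + z.2) ∂(m.prod τ)‖ ^ 2 ≤
      c * ∫ z, ‖h z‖ ^ 2 ∂(m.prod τ) := by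
  have h2 : Integrable (fun z => ‖h z‖ ^ 2) (m.prod τ) :=
    (memLp_two_iff_integrable_sq_norm hh.1).1 hh
  set G : ℤ → ℝ → ℂ := fun k t => ∫ s, h (s, t) * fexp k (s + t) ∂m with hG
  have hint : ∀ k : ℤ, Integrable (fun z : ℝ × ℝ => h z * fexp k (z.1 + z.2)) (m.prod τ) :=
    fun k => hh.integrable_mul_fexp (by fun_prop) k
  have e1 : ∀ k : ℤ, ∫ z, h z * fexp k (z.1 + z.2) ∂(m.prod τ) = ∫ t, G k t ∂τ :=
    fun k => integral_prod_symm _ (hint k)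
  have hGn : ∀ (k : ℤ) t, ‖G k t‖ = ‖∫ s, h (s, t) * fexp k s ∂m‖ := by
    intro k t
    have : G k t = (∫ s, h (s, t) * fexp k s ∂m) * fexp k t := by
      rw [hG, ← integral_mul_const]
      simp_rw [fexp_add_right, mul_assoc]
    rw [this, norm_mul, norm_fexp, mul_one]
  have hGs : ∀ t, ∑ k ∈ Λ, ‖G k t‖ ^ 2 ≤ c * ∫ s, ‖h (s, t)‖ ^ 2 ∂m := by
    intro t
    simp_rw [hGn]
    exact hup _
  have hR : Integrable (fun t => c * ∫ s, ‖h (s, t)‖ ^ 2 ∂m) τ :=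
    h2.integral_prod_right.const_mul c
  have hGm : ∀ k, AEStronglyMeasurable (G k) τ := fun k => (hint k).integral_prod_right.1
  have hGi : ∀ k ∈ Λ, Integrable (fun t => ‖G k t‖ ^ 2) τ := by
    intro k hk
    refine hR.mono' ((hGm k).norm.pow 2) (ae_of_all _ fun t => ?_)
    rw [Real.norm_of_nonneg (by positivity)]
    exact (Finset.single_le_sum (f := fun k => ‖G k t‖ ^ 2) (fun _ _ => by positivity) hk).trans
      (hGs t)
  calc ∑ k ∈ Λ, ‖∫ z, h z * fexp k (z.1 + z.2) ∂(m.prod τ)‖ ^ 2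
      ≤ ∑ k ∈ Λ, ∫ t, ‖G k t‖ ^ 2 ∂τ := by
        refine Finset.sum_le_sum fun k hk => ?_
        rw [e1]
        exact sq_norm_integral_le (hGm k) (hGi k hk)
    _ = ∫ t, ∑ k ∈ Λ, ‖G k t‖ ^ 2 ∂τ := (integral_finsetSum _ hGi).symm
    _ ≤ ∫ t, c * ∫ s, ‖h (s, t)‖ ^ 2 ∂m ∂τ :=
        integral_mono (integrable_finsetSum _ hGi) hR hGs
    _ = c * ∫ z, ‖h z‖ ^ 2 ∂(m.prod τ) := by
        rw [integral_const_mul, integral_prod_symm _ h2]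

theorem sum_sq_norm_integral_conv_le
    (hup : ∀ f : ℝ → ℂ, ∑ k ∈ Λ, ‖∫ x, f x * fexp k x ∂m‖ ^ 2 ≤ c * ∫ x, ‖f x‖ ^ 2 ∂m)
    {f : ℝ → ℂ} (hf : MemLp f 2 (m.conv τ)) :
    ∑ k ∈ Λ, ‖∫ x, f x * fexp k x ∂(m.conv τ)‖ ^ 2 ≤ c * ∫ x, ‖f x‖ ^ 2 ∂(m.conv τ) := by
  have hm : MeasurePreserving (fun z : ℝ × ℝ => z.1 + z.2) (m.prod τ) (m.conv τ) :=
    ⟨by fun_prop, rfl⟩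
  have := sum_sq_norm_integral_prod_le hup (hf.comp_measurePreserving hm)
  have e1 : ∀ k : ℤ, ∫ x, f x * fexp k x ∂(m.conv τ)
      = ∫ z, f (z.1 + z.2) * fexp k (z.1 + z.2) ∂(m.prod τ) := fun k =>
    integral_map (by fun_prop) (hf.1.mul (continuous_fexp k).aestronglyMeasurable)
  have e2 : ∫ x, ‖f x‖ ^ 2 ∂(m.conv τ) = ∫ z, ‖f (z.1 + z.2)‖ ^ 2 ∂(m.prod τ) :=
    integral_map (by fun_prop) (hf.1.norm.pow 2)
  simp_rw [e1, e2]
  exact this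

theorem sq_norm_le_two_mul_add (z w : ℂ) : ‖z‖ ^ 2 ≤ 2 * ‖w‖ ^ 2 + 2 * ‖w - z‖ ^ 2 := by
  have : ‖z‖ ≤ ‖w‖ + ‖w - z‖ := by
    simpa using norm_sub_le w (w - z)
  nlinarith [sq_nonneg (‖w‖ - ‖w - z‖), norm_nonneg z, norm_nonneg w, norm_nonneg (w - z)]

/-- Lower estimate on `m ∗ τ` from a lower frame bound for `m`, when the Fourier transform of `τ` is
at least `ε` on `Λ`. The error measures the oscillation of `f` at the size of the support of `τ`. -/
theorem le_sum_sq_norm_integral_conv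
    (hlo : ∀ f : ℝ → ℂ, a * ∫ x, ‖f x‖ ^ 2 ∂m ≤ ∑ k ∈ Λ, ‖∫ x, f x * fexp k x ∂m‖ ^ 2)
    (hup : ∀ f : ℝ → ℂ, ∑ k ∈ Λ, ‖∫ x, f x * fexp k x ∂m‖ ^ 2 ≤ c * ∫ x, ‖f x‖ ^ 2 ∂m)
    {ε : ℝ} (hε : 0 ≤ ε) (hτ : ∀ k ∈ Λ, ε ≤ ‖∫ t, fexp k t ∂τ‖)
    {f : ℝ → ℂ} (hf : Continuous f) {C : ℝ} (hC : ∀ x, ‖f x‖ ≤ C) :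
    ε ^ 2 * (a * ∫ x, ‖f x‖ ^ 2 ∂m) ≤ 2 * ∑ k ∈ Λ, ‖∫ x, f x * fexp k x ∂(m.conv τ)‖ ^ 2 +
      2 * (c * ∫ z, ‖f (z.1 + z.2) - f z.1‖ ^ 2 ∂(m.prod τ)) := by
  have h1 : MemLp (fun z : ℝ × ℝ => f (z.1 + z.2)) 2 (m.prod τ) :=
    MemLp.of_bound (hf.comp (by fun_prop)).aestronglyMeasurable C (ae_of_all _ fun _ => hC _)
  have h2 : MemLp (fun z : ℝ × ℝ => f z.1) 2 (m.prod τ) :=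
    MemLp.of_bound (hf.comp (by fun_prop)).aestronglyMeasurable C (ae_of_all _ fun _ => hC _)
  have e1 : ∀ k : ℤ, ∫ x, f x * fexp k x ∂(m.conv τ)
      = ∫ z, f (z.1 + z.2) * fexp k (z.1 + z.2) ∂(m.prod τ) := fun k =>
    integral_map (by fun_prop) (hf.mul (continuous_fexp k)).aestronglyMeasurable
  have e2 : ∀ k : ℤ, ∫ z, f z.1 * fexp k (z.1 + z.2) ∂(m.prod τ)
      = (∫ x, f x * fexp k x ∂m) * ∫ t, fexp k t ∂τ := by
    intro k
    rw [← integral_prod_mul]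
    simp_rw [fexp_add_right, mul_assoc]
  have h3 := sum_sq_norm_integral_prod_le (τ := τ) hup (h1.sub h2)
  have e3 : ∀ k : ℤ, ∫ z, (f (z.1 + z.2) - f z.1) * fexp k (z.1 + z.2) ∂(m.prod τ)
      = ∫ x, f x * fexp k x ∂(m.conv τ) - (∫ x, f x * fexp k x ∂m) * ∫ t, fexp k t ∂τ := by
    intro k
    rw [e1, ← e2, ← integral_sub (h1.integrable_mul_fexp (by fun_prop) k)
      (h2.integrable_mul_fexp (by fun_prop) k)]
    simp_rw [sub_mul]
  simp only [Pi.sub_apply, e3] at h3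
  calc ε ^ 2 * (a * ∫ x, ‖f x‖ ^ 2 ∂m)
      ≤ ε ^ 2 * ∑ k ∈ Λ, ‖∫ x, f x * fexp k x ∂m‖ ^ 2 := by gcongr; exact hlo f
    _ ≤ ∑ k ∈ Λ, ‖(∫ x, f x * fexp k x ∂m) * ∫ t, fexp k t ∂τ‖ ^ 2 := by
        rw [Finset.mul_sum]
        refine Finset.sum_le_sum fun k hk => ?_
        rw [norm_mul, mul_pow, mul_comm]
        gcongr
        exact hτ k hk
    _ ≤ ∑ k ∈ Λ, (2 * ‖∫ x, f x * fexp k x ∂(m.conv τ)‖ ^ 2 +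
          2 * ‖∫ x, f x * fexp k x ∂(m.conv τ) -
            (∫ x, f x * fexp k x ∂m) * ∫ t, fexp k t ∂τ‖ ^ 2) :=
        Finset.sum_le_sum fun k _ => sq_norm_le_two_mul_add _ _
    _ ≤ _ := by
        rw [Finset.sum_add_distrib, ← Finset.mul_sum, ← Finset.mul_sum]
        gcongr

end Conv

/-! ### Tails of Cantor-Moran measures -/

theorem WeaklyConverges.tendsto_integral_complex {m : ℕ → Measure ℝ} {m' : Measure ℝ}
    [∀ n, IsProbabilityMeasure (m n)] [IsProbabilityMeasure m'] (h : WeaklyConverges m m')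
    {f : ℝ → ℂ} (hf : Continuous f) {C : ℝ} (hC : ∀ x, ‖f x‖ ≤ C) :
    Tendsto (fun n => ∫ x, f x ∂(m n)) atTop (𝓝 (∫ x, f x ∂m')) := by
  have hre := h (BoundedContinuousFunction.ofNormedAddCommGroup (fun x => (f x).re)
    (Complex.continuous_re.comp hf) C fun x => (Complex.abs_re_le_norm _).trans (hC x))
  have him := h (BoundedContinuousFunction.ofNormedAddCommGroup (fun x => (f x).im)
    (Complex.continuous_im.comp hf) C fun x => (Complex.abs_im_le_norm _).trans (hC x))
  simp only [BoundedContinuousFunction.coe_ofNormedAddCommGroup] at hre him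
  have hi : ∀ (ν : Measure ℝ) [IsProbabilityMeasure ν],
      ∫ x, f x ∂ν = ((∫ x, (f x).re ∂ν : ℝ) : ℂ) + ((∫ x, (f x).im ∂ν : ℝ) : ℂ) * Complex.I := by
    intro ν _
    exact (integral_re_add_im (𝕜 := ℂ)
      (Integrable.of_bound hf.aestronglyMeasurable C (ae_of_all _ hC))).symm
  simp_rw [hi]
  exact ((Complex.continuous_ofReal.tendsto _).comp hre).add
    (((Complex.continuous_ofReal.tendsto _).comp him).mul_const _)

theorem WeaklyConverges.tendsto_charFun {m : ℕ → Measure ℝ} {m' : Measure ℝ}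
    [∀ n, IsProbabilityMeasure (m n)] [IsProbabilityMeasure m'] (h : WeaklyConverges m m')
    (t : ℝ) : Tendsto (fun n => charFun (m n) t) atTop (𝓝 (charFun m' t)) := by
  simp_rw [charFun_apply_real]
  refine h.tendsto_integral_complex (by fun_prop) (C := 1) fun x => ?_
  rw [← Complex.ofReal_mul, Complex.norm_exp_ofReal_mul_I]

theorem finConv_add (m : ℕ → Measure ℝ) [∀ k, IsProbabilityMeasure (m k)] (n k : ℕ) :
    finConv m (n + k) = (finConv m n).conv (finConv (fun j => m (n + j)) k) := by
  have := isProbabilityMeasure_finConv m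
  have := isProbabilityMeasure_finConv fun j => m (n + j)
  induction k with
  | zero => simp [finConv]
  | succ k ih =>
    rw [← add_assoc, finConv, ih, finConv, Measure.conv_assoc]

theorem ae_uniformDirac {A : Finset ℝ} {p : ℝ → Prop} (h : ∀ x ∈ A, p x) :
    ∀ᵐ x ∂(uniformDirac A), p x := by
  refine Measure.ae_smul_measure ?_ _
  rw [← Measure.sum_coe_finset, Measure.ae_sum_iff]
  rintro ⟨x, hx⟩
  rw [ae_dirac_eq]
  exact h x hx

section Tail

variable {N : ℕ → ℕ} {B : ℕ → Finset ℤ}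

/-- The Cantor-Moran measure is the convolution of its finite part of level `n` and its tail. -/
theorem cantorMoran_eq_conv (hN : ∀ n, 2 ≤ N n) (hne : ∀ n, (B n).Nonempty)
    (hB : ∀ n, B n ⊆ Finset.Ico 0 (N n : ℤ)) (n : ℕ) :
    cantorMoran N B = (finConv (cantorMoranFactor N B) n).conv (cantorMoranTail N B n) := by
  have hs : ∀ k, IsProbabilityMeasure (cantorMoranFactor N B k) := fun k =>
    (cantorMoranFactor_spec hN hne hB k).1
  obtain ⟨_, h0⟩ := weaklyConverges_cantorMoran hN hne hB
  obtain ⟨_, hn⟩ := weaklyConverges_cantorMoranTail hN hne hB n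
  have := isProbabilityMeasure_finConv (cantorMoranFactor N B)
  have := isProbabilityMeasure_finConv fun k => cantorMoranFactor N B (n + k)
  refine Measure.ext_of_charFun (funext fun t => ?_)
  rw [charFun_conv]
  have h1 := (h0.tendsto_charFun t).comp (tendsto_add_atTop_nat n)
  refine tendsto_nhds_unique h1 (((hn.tendsto_charFun t).const_mul _).congr fun k => ?_)
  rw [Function.comp_apply, add_comm k n, finConv_add, charFun_conv]

theorem ae_cantorMoranFactor_mem_Icc (hN : ∀ n, 2 ≤ N n)
    (hB : ∀ n, B n ⊆ Finset.Ico 0 (N n : ℤ)) (k : ℕ) :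
    ∀ᵐ x ∂(cantorMoranFactor N B k),
      x ∈ Set.Icc (0 : ℝ) ((scale N k : ℝ)⁻¹ - (scale N (k + 1) : ℝ)⁻¹) := by
  refine ae_uniformDirac fun x hx => ?_
  obtain ⟨b, hb, rfl⟩ := Finset.mem_image.1 hx
  have hb' := Finset.mem_Ico.1 (hB k hb)
  have h0 : (0 : ℝ) ≤ b := by exact_mod_cast hb'.1
  have h1 : (b : ℝ) ≤ N k - 1 := by
    have : b ≤ N k - 1 := by omega
    exact_mod_cast this
  have hs : ∏ j ∈ Finset.range (k + 1), (N j : ℝ) = scale N (k + 1) := by simp [scale]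
  have hP : (0 : ℝ) < scale N k := by exact_mod_cast scale_pos hN k
  have hNk : (0 : ℝ) < N k := by have := hN k; positivity
  rw [hs, scale_succ]
  push_cast
  refine ⟨by positivity, ?_⟩
  have e : (scale N k : ℝ)⁻¹ - ((scale N k : ℝ) * N k)⁻¹ = (N k - 1) / (scale N k * N k) := by
    field_simp
  rw [e]
  gcongr

theorem ae_cantorMoranTail_mem_Icc (hN : ∀ n, 2 ≤ N n) (hne : ∀ n, (B n).Nonempty)
    (hB : ∀ n, B n ⊆ Finset.Ico 0 (N n : ℤ)) (n : ℕ) :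
    ∀ᵐ x ∂(cantorMoranTail N B n), x ∈ Set.Icc (0 : ℝ) (scale N n : ℝ)⁻¹ := by
  have hs := cantorMoranFactor_spec hN hne hB
  have : ∀ k, IsProbabilityMeasure (cantorMoranFactor N B (n + k)) := fun k => (hs _).1
  have hu : Summable fun k : ℕ => (1 / 2 : ℝ) ^ (n + k) := by
    simp_rw [pow_add]
    exact summable_geometric_two.mul_left _
  have hm := aemeasurable_tsum_infinitePi (fun k => cantorMoranFactor N B (n + k)) _ hu
    fun k => (hs _).2
  refine (ae_map_iff hm measurableSet_Icc).2 ?_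
  have hk : ∀ᵐ x ∂(Measure.infinitePi fun k => cantorMoranFactor N B (n + k)), ∀ k,
      x k ∈ Set.Icc (0 : ℝ) ((scale N (n + k) : ℝ)⁻¹ - (scale N (n + (k + 1)) : ℝ)⁻¹) := by
    rw [ae_all_iff]
    intro k
    have h' := ae_cantorMoranFactor_mem_Icc hN hB (n + k)
    rw [← Measure.infinitePi_map_eval (fun k => cantorMoranFactor N B (n + k)) k] at h'
    exact ae_of_ae_map (measurable_pi_apply k).aemeasurable h'
  filter_upwards [hk] with x hx
  refine ⟨tsum_nonneg fun k => (hx k).1, Real.tsum_le_of_sum_range_le (fun k => (hx k).1)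
    fun j => ?_⟩
  calc ∑ k ∈ Finset.range j, x k
      ≤ ∑ k ∈ Finset.range j, ((scale N (n + k) : ℝ)⁻¹ - (scale N (n + (k + 1)) : ℝ)⁻¹) :=
        Finset.sum_le_sum fun k _ => (hx k).2
    _ = (scale N n : ℝ)⁻¹ - (scale N (n + j) : ℝ)⁻¹ := by
        rw [Finset.sum_range_sub' fun k => (scale N (n + k) : ℝ)⁻¹, add_zero]
    _ ≤ _ := by simp

theorem rescaledTail_eq_map (n : ℕ) :
    rescaledTail N B n = (cantorMoranTail N B n).map fun x => (scale N n : ℝ) * x := by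
  simp [rescaledTail, scale]

theorem isProbabilityMeasure_rescaledTail (hN : ∀ n, 2 ≤ N n) (hne : ∀ n, (B n).Nonempty)
    (hB : ∀ n, B n ⊆ Finset.Ico 0 (N n : ℤ)) (n : ℕ) :
    IsProbabilityMeasure (rescaledTail N B n) := by
  have := (weaklyConverges_cantorMoranTail hN hne hB n).1
  exact Measure.isProbabilityMeasure_map (by fun_prop)

theorem ae_rescaledTail_mem_Icc (hN : ∀ n, 2 ≤ N n) (hne : ∀ n, (B n).Nonempty)
    (hB : ∀ n, B n ⊆ Finset.Ico 0 (N n : ℤ)) (n : ℕ) :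
    ∀ᵐ x ∂(rescaledTail N B n), x ∈ Set.Icc (0 : ℝ) 1 := by
  have hP : (0 : ℝ) < scale N n := by exact_mod_cast scale_pos hN n
  rw [rescaledTail_eq_map]
  refine (ae_map_iff (by fun_prop) measurableSet_Icc).2 ?_
  filter_upwards [ae_cantorMoranTail_mem_Icc hN hne hB n] with x hx
  refine ⟨mul_nonneg hP.le hx.1, ?_⟩
  calc _ ≤ (scale N n : ℝ) * (scale N n : ℝ)⁻¹ := by gcongr; exact hx.2
    _ = 1 := mul_inv_cancel₀ hP.ne'

theorem integral_fexp_cantorMoranTail (hN : ∀ n, 2 ≤ N n) (n : ℕ) (ξ : ℝ) :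
    ∫ t, fexp ξ t ∂(cantorMoranTail N B n) = ∫ t, fexp (ξ / scale N n) t ∂(rescaledTail N B n) := by
  have hP : ((scale N n : ℝ) : ℂ) ≠ 0 := by exact_mod_cast (scale_pos hN n).ne'
  rw [rescaledTail_eq_map, integral_map (by fun_prop) (continuous_fexp _).aestronglyMeasurable]
  congr 1
  ext t
  rw [fexp, fexp]
  congr 1
  push_cast at *
  field_simp

end Tail

/-! ### Construction of the frequencies -/

section Construction

variable {N : ℕ → ℕ} {B L : ℕ → Finset ℤ} {a c : ℕ → ℝ}

/-- Level frames along a subsequence of levels, with increasing frequency sets on which the Fourier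
transforms of the tails are bounded below: a new frequency may be moved by multiples of
`N_1 ⋯ N_n`, and an old one becomes small at the scale of the level, where nothing has to be
moved. -/
theorem exists_levelFrame_seq (hN : ∀ n, 2 ≤ N n) (hne : ∀ n, (B n).Nonempty)
    (hB : ∀ n, B n ⊆ Finset.Ico 0 (N n : ℤ))
    (hρ : ¬ WeaklyConverges (rescaledTail N B) rhoMeasure)
    (ha : ∀ n, 0 ≤ a n) (hc : ∀ n, 0 ≤ c n)
    (hF : ∀ n, DigitFrame (N n) (B n) (L n) (a n) (c n)) (h0 : ∀ n, 0 ∈ L n)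
    (hL : ∀ n, ∀ l ∈ L n, ∀ l' ∈ L n, (N n : ℤ) ∣ l - l' → l = l') :
    ∃ ε : ℝ, 0 < ε ∧ ∃ (n : ℕ → ℕ) (Λ : ℕ → Finset ℤ), StrictMono n ∧ Monotone Λ ∧ ∀ j,
      LevelFrame N B (n j) (Λ j) (∏ k ∈ Finset.range (n j), a k) (∏ k ∈ Finset.range (n j), c k) ∧
      ∀ k ∈ Λ j, ε ≤ ‖∫ t, fexp k t ∂(cantorMoranTail N B (n j))‖ := by
  have hprob := isProbabilityMeasure_rescaledTail hN hne hB
  have hsupp := ae_rescaledTail_mem_Icc hN hne hB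
  obtain ⟨ε₁, hε₁, hfreq⟩ := exists_frequently_forall_exists_le_norm_integral_fexp hsupp hρ
  set ε := min ε₁ (1 / 2) with hε
  have hεpos : 0 < ε := lt_min hε₁ (by norm_num)
  have hε1 : ε ≤ ε₁ := min_le_left _ _
  have hε2 : ε ≤ 1 / 2 := min_le_right _ _
  let P : ℕ × Finset ℤ → Prop := fun p =>
    LevelFrame N B p.1 p.2 (∏ k ∈ Finset.range p.1, a k) (∏ k ∈ Finset.range p.1, c k) ∧
      ∀ k ∈ p.2, ε ≤ ‖∫ t, fexp k t ∂(cantorMoranTail N B p.1)‖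
  have hstart : P (0, {0}) := by
    refine ⟨by simpa using levelFrame_zero, fun k hk => ?_⟩
    have := (weaklyConverges_cantorMoranTail hN hne hB 0).1
    rw [Finset.mem_singleton.1 hk]
    simp only [Int.cast_zero, fexp_zero_left]
    simp only [integral_const, probReal_univ, one_smul, norm_one]
    linarith
  have hstep : ∀ p : {p // P p}, ∃ q : {p // P p}, p.1.1 < q.1.1 ∧ p.1.2 ⊆ q.1.2 := by
    rintro ⟨⟨n, Λ⟩, hlev, -⟩
    -- `R` bounds the old frequencies, so that they become at most `1/4` after rescaling.
    obtain ⟨R, hR⟩ : ∃ R : ℕ, ∀ k ∈ Λ, k.natAbs ≤ R :=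
      ⟨Λ.sup Int.natAbs, fun k hk => Finset.le_sup (f := Int.natAbs) hk⟩
    obtain ⟨n', hgood, hn'⟩ := (hfreq.and_eventually (eventually_ge_atTop (n + 1 + 4 * R))).exists
    have hs : (4 * R : ℝ) ≤ scale N n' := by
      have h1 : n' < 2 ^ n' := Nat.lt_two_pow_self
      have h2 := two_pow_le_scale hN n'
      have : 4 * R ≤ scale N n' := by omega
      exact_mod_cast this
    have hP : (0 : ℝ) < scale N n' := by exact_mod_cast scale_pos hN n'
    obtain ⟨Λ', hsub, hlev'⟩ := hlev.exists_of_le hN hne ha hc hF h0 hL (by omega : n ≤ n')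
    choose κ hκ using fun k : ℤ => hgood ((k : ℝ) / scale N n')
    classical
    let κ' : ℤ → ℤ := fun k => if k ∈ Λ then 0 else κ k
    refine ⟨⟨(n', Λ'.image fun k => k + scale N n' * κ' k),
      hlev'.image_add_scale_mul hN hne κ', ?_⟩, by dsimp only; omega, fun k hk => ?_⟩
    · intro k hk
      obtain ⟨k, hk, rfl⟩ := Finset.mem_image.1 hk
      dsimp only
      rw [integral_fexp_cantorMoranTail hN]
      have e : ((k + scale N n' * κ' k : ℤ) : ℝ) / scale N n' = (k : ℝ) / scale N n' + κ' k := by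
        push_cast; field_simp
      rw [e]
      by_cases hkΛ : k ∈ Λ
      · simp only [κ', hkΛ, if_true, Int.cast_zero, add_zero]
        have hk4 : |(k : ℝ) / scale N n'| ≤ 1 / 4 := by
          have h1 : |(k : ℝ)| ≤ R := by
            have := hR k hkΛ
            rw [← Int.cast_abs, Int.abs_eq_natAbs]
            exact_mod_cast this
          rw [abs_div, abs_of_pos hP, div_le_iff₀ hP]
          linarith
        have := one_sub_two_mul_abs_le_norm_integral_fexp (hsupp n') (hk4.trans (by norm_num))
        linarith
      · simp only [κ', hkΛ, if_false]
        exact hε1.trans (hκ k)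
    · exact Finset.mem_image.2 ⟨k, hsub hk, by simp [κ', hk]⟩
  choose g hg1 hg2 using hstep
  let s : ℕ → {p // P p} := fun j => g^[j] ⟨_, hstart⟩
  have hs : ∀ j, s (j + 1) = g (s j) := fun j => Function.iterate_succ_apply' g j _
  refine ⟨ε, hεpos, fun j => (s j).1.1, fun j => (s j).1.2, strictMono_nat_of_lt_succ fun j => ?_,
    monotone_nat_of_le_succ fun j => ?_, fun j => (s j).2⟩
  · rw [hs]; exact hg1 _
  · rw [hs]; exact hg2 _

/-! ### Frame bounds for the Cantor-Moran measure -/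

theorem tendsto_inv_scale (hN : ∀ n, 2 ≤ N n) :
    Tendsto (fun n => (scale N n : ℝ)⁻¹) atTop (𝓝 0) := by
  have h : Tendsto (fun n : ℕ => ((2 : ℝ) ^ n)⁻¹) atTop (𝓝 0) :=
    (tendsto_pow_atTop_atTop_of_one_lt one_lt_two).inv_tendsto_atTop
  refine squeeze_zero (fun n => by positivity) (fun n => ?_) h
  have := two_pow_le_scale hN n
  gcongr
  exact_mod_cast this

theorem tendsto_integral_sq_norm_sub (hN : ∀ n, 2 ≤ N n) (hne : ∀ n, (B n).Nonempty)
    (hB : ∀ n, B n ⊆ Finset.Ico 0 (N n : ℤ)) {f : ℝ → ℂ} (hf : UniformContinuous f) :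
    Tendsto (fun n => ∫ z, ‖f (z.1 + z.2) - f z.1‖ ^ 2
      ∂((finConv (cantorMoranFactor N B) n).prod (cantorMoranTail N B n))) atTop (𝓝 0) := by
  rw [Metric.tendsto_nhds]
  intro η hη
  obtain ⟨δ, hδ, hfδ⟩ := Metric.uniformContinuous_iff.1 hf (√(η / 2)) (by positivity)
  filter_upwards [(tendsto_inv_scale hN).eventually_lt_const hδ] with n hn
  have := isProbabilityMeasure_finConv_cantorMoranFactor (N := N) hne n
  have := (weaklyConverges_cantorMoranTail hN hne hB n).1
  have hae : ∀ᵐ z ∂((finConv (cantorMoranFactor N B) n).prod (cantorMoranTail N B n)),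
      ‖‖f (z.1 + z.2) - f z.1‖ ^ 2‖ ≤ η / 2 := by
    filter_upwards [Measure.quasiMeasurePreserving_snd.ae
      (ae_cantorMoranTail_mem_Icc hN hne hB n)] with z hz
    have hd : dist (z.1 + z.2) z.1 < δ := by
      rw [Real.dist_eq, add_sub_cancel_left, abs_of_nonneg hz.1]
      exact hz.2.trans_lt hn
    have h1 := (hfδ hd).le
    rw [dist_eq_norm] at h1
    rw [Real.norm_of_nonneg (by positivity), ← Real.sq_sqrt (by positivity : 0 ≤ η / 2)]
    gcongr
  have h2 := norm_integral_le_of_norm_le_const hae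
  rw [dist_zero_right]
  simp only [probReal_univ, mul_one] at h2
  linarith

variable {n : ℕ → ℕ} {Λ : ℕ → Finset ℤ} {A C ε : ℝ}

theorem sum_sq_norm_integral_cantorMoran_le (hN : ∀ n, 2 ≤ N n) (hne : ∀ n, (B n).Nonempty)
    (hB : ∀ n, B n ⊆ Finset.Ico 0 (N n : ℤ)) (hΛ : ∀ j, LevelFrame N B (n j) (Λ j)
      (∏ k ∈ Finset.range (n j), a k) (∏ k ∈ Finset.range (n j), c k))
    (hC : ∀ n, ∏ k ∈ Finset.range n, c k ≤ C) {f : ℝ → ℂ} (hf : MemLp f 2 (cantorMoran N B))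
    (j : ℕ) : ∑ k ∈ Λ j, ‖∫ x, f x * fexp k x ∂(cantorMoran N B)‖ ^ 2 ≤
      C * ∫ x, ‖f x‖ ^ 2 ∂(cantorMoran N B) := by
  have := isProbabilityMeasure_finConv_cantorMoranFactor (N := N) hne (n j)
  have := (weaklyConverges_cantorMoranTail hN hne hB (n j)).1
  have e := cantorMoran_eq_conv hN hne hB (n j)
  rw [e] at hf ⊢
  refine (sum_sq_norm_integral_conv_le (hΛ j).upper hf).trans ?_
  gcongr
  exact hC _

/-- Lower frame bound for continuous functions with compact support. -/
theorem le_of_sum_sq_norm_integral_le_of_hasCompactSupport (hN : ∀ n, 2 ≤ N n)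
    (hne : ∀ n, (B n).Nonempty) (hB : ∀ n, B n ⊆ Finset.Ico 0 (N n : ℤ)) (hn : StrictMono n)
    (hΛ : ∀ j, LevelFrame N B (n j) (Λ j)
      (∏ k ∈ Finset.range (n j), a k) (∏ k ∈ Finset.range (n j), c k))
    (hε : 0 ≤ ε) (hτ : ∀ j, ∀ k ∈ Λ j, ε ≤ ‖∫ t, fexp k t ∂(cantorMoranTail N B (n j))‖)
    (hA : ∀ n, A ≤ ∏ k ∈ Finset.range n, a k) (hC : ∀ n, ∏ k ∈ Finset.range n, c k ≤ C)
    {f : ℝ → ℂ} (hf : Continuous f) (hfs : HasCompactSupport f) {S : ℝ}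
    (hS : ∀ j, ∑ k ∈ Λ j, ‖∫ x, f x * fexp k x ∂(cantorMoran N B)‖ ^ 2 ≤ S) :
    ε ^ 2 * (A * ∫ x, ‖f x‖ ^ 2 ∂(cantorMoran N B)) ≤ 2 * S := by
  obtain ⟨K, hK⟩ := hf.bounded_above_of_compact_support hfs
  have hw := (weaklyConverges_cantorMoran hN hne hB).2
    (BoundedContinuousFunction.ofNormedAddCommGroup (fun x => ‖f x‖ ^ 2) (by fun_prop) (K ^ 2)
      fun x => by
        rw [Real.norm_of_nonneg (by positivity)]
        gcongr
        exact hK x)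
  simp only [BoundedContinuousFunction.coe_ofNormedAddCommGroup] at hw
  have h1 := ((hw.comp hn.tendsto_atTop).const_mul A).const_mul (ε ^ 2)
  have h2 := ((((tendsto_integral_sq_norm_sub hN hne hB
    (hfs.uniformContinuous_of_continuous hf)).comp hn.tendsto_atTop).const_mul C).const_mul
      2).const_add (2 * S)
  simp only [mul_zero, add_zero] at h2
  refine le_of_tendsto_of_tendsto' h1 h2 fun j => ?_
  have := isProbabilityMeasure_finConv_cantorMoranFactor (N := N) hne (n j)
  have := (weaklyConverges_cantorMoranTail hN hne hB (n j)).1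
  have h3 := le_sum_sq_norm_integral_conv (τ := cantorMoranTail N B (n j)) (hΛ j).lower
    (hΛ j).upper hε (hτ j) hf hK
  rw [← cantorMoran_eq_conv hN hne hB] at h3
  simp only [Function.comp_apply]
  calc _ ≤ _ := by gcongr; exact hA _
    _ ≤ _ := h3
    _ ≤ _ := by
      gcongr
      · exact hS j
      · exact hC _

/-- Lower frame bound for all of `L²`. It follows by density because the upper frame bound controls
the effect of an `L²`-small perturbation of `f`; the factor `8` comes from three uses of
`‖z‖² ≤ 2 ‖w‖² + 2 ‖w - z‖²`. -/
theorem le_of_sum_sq_norm_integral_le (hN : ∀ n, 2 ≤ N n)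
    (hne : ∀ n, (B n).Nonempty) (hB : ∀ n, B n ⊆ Finset.Ico 0 (N n : ℤ)) (hn : StrictMono n)
    (hΛ : ∀ j, LevelFrame N B (n j) (Λ j)
      (∏ k ∈ Finset.range (n j), a k) (∏ k ∈ Finset.range (n j), c k))
    (hε : 0 < ε) (hτ : ∀ j, ∀ k ∈ Λ j, ε ≤ ‖∫ t, fexp k t ∂(cantorMoranTail N B (n j))‖)
    (hApos : 0 < A) (hA : ∀ n, A ≤ ∏ k ∈ Finset.range n, a k)
    (hC : ∀ n, ∏ k ∈ Finset.range n, c k ≤ C)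
    {f : ℝ → ℂ} (hf : MemLp f 2 (cantorMoran N B)) {S : ℝ}
    (hS : ∀ j, ∑ k ∈ Λ j, ‖∫ x, f x * fexp k x ∂(cantorMoran N B)‖ ^ 2 ≤ S) :
    ε ^ 2 * A / 8 * ∫ x, ‖f x‖ ^ 2 ∂(cantorMoran N B) ≤ S := by
  have := (weaklyConverges_cantorMoran hN hne hB).1
  have hC0 : 1 ≤ C := by simpa using hC 0
  -- An error `η` in the squared `L²`-distance to `f` changes the inequality by `D * η`.
  set D := C + ε ^ 2 * A / 4 with hD
  have hDpos : 0 < D := by positivity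
  refine le_of_forall_pos_le_add fun δ hδ => ?_
  have hf' : MemLp f (ENNReal.ofReal 2) (cantorMoran N B) := by simpa using hf
  obtain ⟨g, hgs, hfg, hg, hg2⟩ := hf'.exists_hasCompactSupport_integral_rpow_sub_le two_pos
    (div_pos hδ hDpos)
  simp only [Real.rpow_two] at hfg
  have hg2 : MemLp g 2 (cantorMoran N B) := by simpa using hg2
  have hsub : MemLp (f - g) 2 (cantorMoran N B) := hf.sub hg2
  have hSg : ∀ j, ∑ k ∈ Λ j, ‖∫ x, g x * fexp k x ∂(cantorMoran N B)‖ ^ 2 ≤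
      2 * S + 2 * (C * (δ / D)) := by
    intro j
    have h1 := sum_sq_norm_integral_cantorMoran_le hN hne hB hΛ hC hsub j
    calc _ ≤ ∑ k ∈ Λ j, (2 * ‖∫ x, f x * fexp k x ∂(cantorMoran N B)‖ ^ 2 +
          2 * ‖∫ x, (f - g) x * fexp k x ∂(cantorMoran N B)‖ ^ 2) := by
          refine Finset.sum_le_sum fun k _ => ?_
          have e : ∫ x, (f - g) x * fexp k x ∂(cantorMoran N B) =
              ∫ x, f x * fexp k x ∂(cantorMoran N B) - ∫ x, g x * fexp k x ∂(cantorMoran N B) := by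
            rw [← integral_sub (hf.integrable_mul_fexp (u := fun x => x) measurable_id k)
              (hg2.integrable_mul_fexp (u := fun x => x) measurable_id k)]
            simp [sub_mul]
          rw [e]
          exact sq_norm_le_two_mul_add _ _
      _ ≤ _ := by
          rw [Finset.sum_add_distrib, ← Finset.mul_sum, ← Finset.mul_sum]
          gcongr
          · exact hS j
          · refine h1.trans ?_
            gcongr
            simpa using hfg
  have h2 := le_of_sum_sq_norm_integral_le_of_hasCompactSupport hN hne hB hn hΛ hε.le hτ hA hC hg
    hgs hSg
  have h3 : ∫ x, ‖f x‖ ^ 2 ∂(cantorMoran N B) ≤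
      2 * ∫ x, ‖g x‖ ^ 2 ∂(cantorMoran N B) + 2 * (δ / D) := by
    have i1 := (memLp_two_iff_integrable_sq_norm hf.1).1 hf
    have i2 := (memLp_two_iff_integrable_sq_norm hg2.1).1 hg2
    have i3 := (memLp_two_iff_integrable_sq_norm hsub.1).1 hsub
    calc _ ≤ ∫ x, (2 * ‖g x‖ ^ 2 + 2 * ‖(f - g) x‖ ^ 2) ∂(cantorMoran N B) := by
          refine integral_mono i1 ((i2.const_mul 2).add (i3.const_mul 2)) fun x => ?_
          have := sq_norm_le_two_mul_add (f x) (g x)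
          rwa [norm_sub_rev] at this
      _ ≤ _ := by
          rw [integral_add (i2.const_mul 2) (i3.const_mul 2), integral_const_mul,
            integral_const_mul]
          gcongr
          simpa using hfg
  have h4 : D * (δ / D) = δ := by field_simp
  have h5 := mul_le_mul_of_nonneg_left h3 (by positivity : 0 ≤ ε ^ 2 * A)
  rw [hD] at h4
  rw [hD] at h2 h5
  nlinarith

/-- The frame inequalities for the union of the increasing frequency sets. -/
theorem exists_fourierFrame (hN : ∀ n, 2 ≤ N n) (hne : ∀ n, (B n).Nonempty)
    (hB : ∀ n, B n ⊆ Finset.Ico 0 (N n : ℤ))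
    (hρ : ¬ WeaklyConverges (rescaledTail N B) rhoMeasure)
    (ha : ∀ n, 0 ≤ a n) (hc : ∀ n, 0 ≤ c n)
    (hF : ∀ n, DigitFrame (N n) (B n) (L n) (a n) (c n)) (h0 : ∀ n, 0 ∈ L n)
    (hL : ∀ n, ∀ l ∈ L n, ∀ l' ∈ L n, (N n : ℤ) ∣ l - l' → l = l')
    (hApos : 0 < A) (hA : ∀ n, A ≤ ∏ k ∈ Finset.range n, a k)
    (hC : ∀ n, ∏ k ∈ Finset.range n, c k ≤ C) :
    ∃ Λ : Set ℝ, Λ ⊆ Set.range (Int.cast : ℤ → ℝ) ∧ ∃ A' : ℝ, 0 < A' ∧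
      ∀ f : ℝ → ℂ, MemLp f 2 (cantorMoran N B) →
        Summable (fun l : Λ => ‖∫ x, f x * fexp l x ∂(cantorMoran N B)‖ ^ 2) ∧
        A' * ∫ x, ‖f x‖ ^ 2 ∂(cantorMoran N B) ≤
          ∑' l : Λ, ‖∫ x, f x * fexp l x ∂(cantorMoran N B)‖ ^ 2 ∧
        ∑' l : Λ, ‖∫ x, f x * fexp l x ∂(cantorMoran N B)‖ ^ 2 ≤
          C * ∫ x, ‖f x‖ ^ 2 ∂(cantorMoran N B) := by
  obtain ⟨ε, hε, n, Λ, hn, hmono, h⟩ := exists_levelFrame_seq hN hne hB hρ ha hc hF h0 hL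
  set Λ' : Set ℝ := {x | ∃ j, ∃ k ∈ Λ j, (k : ℝ) = x} with hΛ'
  refine ⟨Λ', ?_, ε ^ 2 * A / 8, by positivity, fun f hf => ?_⟩
  · rintro _ ⟨j, k, -, rfl⟩
    exact ⟨k, rfl⟩
  set G : ℝ → ℝ := fun l => ‖∫ x, f x * fexp l x ∂(cantorMoran N B)‖ ^ 2 with hG
  have hG0 : ∀ l, 0 ≤ G l := fun l => by positivity
  have hup := sum_sq_norm_integral_cantorMoran_le hN hne hB (fun j => (h j).1) hC hf
  have hfin : ∀ F : Finset Λ', ∑ l ∈ F, G l ≤ C * ∫ x, ‖f x‖ ^ 2 ∂(cantorMoran N B) := by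
    intro F
    choose J K hK hKx using fun l : Λ' => l.2
    refine le_trans ?_ (hup (F.sup J))
    have hinj : Function.Injective K := fun l l' e => Subtype.ext (by rw [← hKx l, ← hKx l', e])
    calc ∑ l ∈ F, G l = ∑ k ∈ F.image K, G k := by
          rw [Finset.sum_image hinj.injOn]
          exact Finset.sum_congr rfl fun l _ => by rw [hKx]
      _ ≤ _ := by
          refine Finset.sum_le_sum_of_subset_of_nonneg (fun k hk => ?_) fun _ _ _ => hG0 _
          obtain ⟨l, hl, rfl⟩ := Finset.mem_image.1 hk
          exact hmono (Finset.le_sup hl) (hK l)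
  have hsum : Summable fun l : Λ' => G l :=
    summable_of_sum_le (fun _ => hG0 _) hfin
  refine ⟨hsum, ?_, hsum.tsum_le_of_sum_le hfin⟩
  refine le_of_sum_sq_norm_integral_le hN hne hB hn (fun j => (h j).1) hε (fun j => (h j).2)
    hApos hA hC hf fun j => ?_
  have hmem : ∀ k ∈ Λ j, (k : ℝ) ∈ Λ' := fun k hk => ⟨j, k, hk, rfl⟩
  have := hsum.sum_le_tsum ((Λ j).attach.map ⟨fun k => (⟨(k.1 : ℝ), hmem k.1 k.2⟩ : Λ'),
    fun k k' e => by simpa using congrArg Subtype.val e⟩) fun _ _ => hG0 _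
  rw [Finset.sum_map] at this
  exact (Finset.sum_attach (Λ j) fun k : ℤ => G k).symm.trans_le this

end Construction

/-! ### Hadamard triples and frame triples as digit frames -/

theorem sq_norm_expMatrix_transpose_mulVec (N : ℕ) (B L : Finset ℤ) (w : ℤ → ℂ) :
    ‖WithLp.toLp 2 ((expMatrix N B L).transpose.mulVec fun b => w b)‖ ^ 2 =
      (B.card : ℝ)⁻¹ * ∑ l ∈ L, ‖∑ b ∈ B, fexp l (b / N) * w b‖ ^ 2 := by
  rw [EuclideanSpace.norm_sq_eq, Finset.mul_sum, ← Finset.sum_coe_sort L]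
  refine Finset.sum_congr rfl fun l _ => ?_
  have e : ((expMatrix N B L).transpose.mulVec fun b : B => w b) l =
      ((1 / Real.sqrt (B.card : ℝ) : ℝ) : ℂ) * ∑ b ∈ B, fexp l (b / N) * w b := by
    rw [Matrix.mulVec, dotProduct, Finset.mul_sum, ← Finset.sum_coe_sort B]
    refine Finset.sum_congr rfl fun b _ => ?_
    rw [Matrix.transpose_apply, expMatrix, Matrix.of_apply, fexp, mul_assoc]
    congr 3
    push_cast
    ring
  rw [PiLp.toLp_apply, e, norm_mul, mul_pow, Complex.norm_real, Real.norm_of_nonneg (by positivity), div_pow,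
    Real.sq_sqrt (by positivity), one_pow, one_div]

theorem IsFrameTriple.digitFrame {N : ℕ} {B L : Finset ℤ} {c₁ c₂ : ℝ}
    (h : IsFrameTriple N B L c₁ c₂) : DigitFrame N B L (c₁ ^ 2) (c₂ ^ 2) := by
  have hw : ∀ w : ℤ → ℂ, ‖(WithLp.toLp 2 fun b : B => w b : EuclideanSpace ℂ B)‖ ^ 2 =
      ∑ b ∈ B, ‖w b‖ ^ 2 := by
    intro w
    rw [EuclideanSpace.norm_sq_eq, ← Finset.sum_coe_sort B]
  refine ⟨fun w => ?_, fun w => ?_⟩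
  · rw [← sq_norm_expMatrix_transpose_mulVec, ← hw, ← mul_pow]
    have := h.pos
    gcongr
    exact h.lower (WithLp.toLp 2 fun b : B => w b)
  · rw [← sq_norm_expMatrix_transpose_mulVec, ← hw, ← mul_pow]
    gcongr
    exact h.upper (WithLp.toLp 2 fun b : B => w b)

theorem IsHadamardTriple.isFrameTriple {N : ℕ} {B L : Finset ℤ} (h : IsHadamardTriple N B L) :
    IsFrameTriple N B L 1 1 := by
  have h1 : expMatrix N B L * (expMatrix N B L).conjTranspose = 1 :=
    (Matrix.mul_eq_one_comm_of_card_eq _ _ _ (by simpa using h.card_eq)).1 h.unitary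
  have h2 : (expMatrix N B L).transpose.conjTranspose * (expMatrix N B L).transpose = 1 := by
    rw [← Matrix.transpose_one, ← h1, Matrix.transpose_mul]
    rfl
  have hn : ∀ w : EuclideanSpace ℂ B,
      ‖WithLp.toLp 2 ((expMatrix N B L).transpose.mulVec w.ofLp)‖ = ‖w‖ := by
    intro w
    have hsq : ∀ {ι : Type} [Fintype ι] (v : EuclideanSpace ℂ ι),
        ((‖v‖ ^ 2 : ℝ) : ℂ) = dotProduct (star v.ofLp) v.ofLp := by
      intro ι _ v
      rw [EuclideanSpace.norm_sq_eq, dotProduct]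
      push_cast
      refine Finset.sum_congr rfl fun i _ => ?_
      rw [Pi.star_apply, ← Complex.conj_mul']
      rfl
    refine (sq_eq_sq₀ (norm_nonneg _) (norm_nonneg _)).1 ?_
    refine Complex.ofReal_injective ?_
    rw [hsq, hsq, Matrix.star_mulVec, ← Matrix.dotProduct_mulVec, Matrix.mulVec_mulVec, h2,
      Matrix.one_mulVec]
  exact ⟨h.two_le, one_pos, le_rfl, fun w => by rw [hn, one_mul], fun w => by rw [hn, one_mul]⟩

/-- Normalization of the frequencies of a digit frame: after a translation, which only multiplies
`w` by unimodular factors, and a reduction modulo `N`, they contain `0` and are incongruent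
modulo `N`. As each row has norm `1`, at most `c` frequencies share a residue, so the lower bound
drops by a factor of at most `⌊c⌋`, which is `1` if `c < 2`. -/
theorem DigitFrame.exists_normalized {N : ℕ} (hN : 0 < N) {B L : Finset ℤ} (hB : B.Nonempty)
    {a c : ℝ} (ha : 0 < a) (h : DigitFrame N B L a c) :
    1 ≤ ⌊c⌋₊ ∧ ∃ L' : Finset ℤ, 0 ∈ L' ∧ (∀ l ∈ L', ∀ l' ∈ L', (N : ℤ) ∣ l - l' → l = l') ∧
      DigitFrame N B L' (a / ⌊c⌋₊) c := by
  have hM : (0 : ℝ) < B.card := by exact_mod_cast hB.card_pos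
  have hNR : (N : ℝ) ≠ 0 := by exact_mod_cast hN.ne'
  obtain ⟨l₀, hl₀⟩ : L.Nonempty := by
    by_contra hL
    rw [Finset.not_nonempty_iff_eq_empty] at hL
    have := h.lower fun _ => 1
    simp only [hL, Finset.sum_empty, mul_zero, norm_one, one_pow, Finset.sum_const,
      nsmul_eq_mul, mul_one] at this
    nlinarith
  set r : ℤ → ℤ := fun l => (l - l₀) % N with hr
  have hrow : ∀ (l b : ℤ), fexp (r l) (b / N) = fexp l (b / N) * fexp (-l₀) (b / N) := by
    intro l b
    have e : ((l : ℝ) + -l₀) = r l + ((N : ℝ) * ((l - l₀) / N : ℤ)) := by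
      have := Int.emod_add_mul_ediv (l - l₀) N
      have h2 : ((l - l₀ : ℤ) : ℝ) = ((r l + N * ((l - l₀) / N) : ℤ) : ℝ) := by rw [hr, this]
      push_cast at h2
      linarith
    rw [← fexp_add_left, e, fexp_add_left,
      fexp_eq_one_of_mul_eq_int (ξ := N * ((l - l₀) / N : ℤ)) (b * ((l - l₀) / N)), mul_one]
    push_cast
    field_simp
  set φ : (ℤ → ℂ) → ℤ → ℝ := fun w l => ‖∑ b ∈ B, fexp l (b / N) * w b‖ ^ 2 with hφ
  have hφ0 : ∀ w l, 0 ≤ φ w l := fun w l => by positivity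
  set L' := L.image r with hL'
  set q : ℤ → ℕ := fun l' => (L.filter fun l => r l = l').card with hq
  -- The digit frame inequalities, applied to a twisted vector and sorted by residues.
  have hsum : ∀ w, ∑ l ∈ L, ‖∑ b ∈ B, fexp l (b / N) * (fexp (-l₀) (b / N) * w b)‖ ^ 2 =
      ∑ l' ∈ L', (q l' : ℝ) * φ w l' := by
    intro w
    have := Finset.sum_comp (s := L) (φ w) r
    simp only [nsmul_eq_mul] at this
    rw [← this]
    refine Finset.sum_congr rfl fun l _ => ?_
    simp only [hφ, hrow, mul_assoc]
  have hlow : ∀ w : ℤ → ℂ, a * ∑ b ∈ B, ‖w b‖ ^ 2 ≤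
      (B.card : ℝ)⁻¹ * ∑ l' ∈ L', (q l' : ℝ) * φ w l' := by
    intro w
    have := h.lower fun b => fexp (-l₀) (b / N) * w b
    rw [hsum] at this
    simpa using this
  have hupp : ∀ w : ℤ → ℂ, (B.card : ℝ)⁻¹ * ∑ l' ∈ L', (q l' : ℝ) * φ w l' ≤
      c * ∑ b ∈ B, ‖w b‖ ^ 2 := by
    intro w
    have := h.upper fun b => fexp (-l₀) (b / N) * w b
    rw [hsum] at this
    simpa using this
  have hq1 : ∀ l' ∈ L', 1 ≤ q l' := by
    intro l' hl'
    obtain ⟨l, hl, e⟩ := Finset.mem_image.1 hl'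
    exact Finset.card_pos.2 ⟨l, Finset.mem_filter.2 ⟨hl, e⟩⟩
  have hqc : ∀ l' ∈ L', (q l' : ℝ) ≤ c := by
    intro l' hl'
    -- The conjugate of the row of `l'` as a test vector.
    set w : ℤ → ℂ := fun b => (starRingEnd ℂ) (fexp l' (b / N)) with hw
    have h1 : φ w l' = (B.card : ℝ) ^ 2 := by
      have : ∀ b ∈ B, fexp l' (b / N) * w b = 1 := fun b _ => by
        rw [hw, Complex.mul_conj', norm_fexp]; simp
      simp only [hφ]
      rw [Finset.sum_congr rfl this]
      simp
    have h2 : ∑ b ∈ B, ‖w b‖ ^ 2 = B.card := by simp [hw]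
    have h3 := hupp w
    have h4 := Finset.single_le_sum (f := fun l' => (q l' : ℝ) * φ w l')
      (fun l' _ => mul_nonneg (Nat.cast_nonneg _) (hφ0 w l')) hl'
    simp only [h1] at h4
    have h5 := mul_le_mul_of_nonneg_left h4 (inv_nonneg.2 hM.le)
    rw [h2] at h3
    have e : (B.card : ℝ)⁻¹ * (q l' * (B.card : ℝ) ^ 2) = q l' * B.card := by field_simp
    rw [e] at h5
    exact le_of_mul_le_mul_right (h5.trans h3) hM
  have h0 : (0 : ℤ) ∈ L' := Finset.mem_image.2 ⟨l₀, hl₀, by simp [hr]⟩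
  have hqf : ∀ l' ∈ L', q l' ≤ ⌊c⌋₊ := fun l' hl' => Nat.le_floor (hqc l' hl')
  have hfl : 1 ≤ ⌊c⌋₊ := (hq1 0 h0).trans (hqf 0 h0)
  have hflR : (0 : ℝ) < ⌊c⌋₊ := by exact_mod_cast hfl
  refine ⟨hfl, L', h0, ?_, fun w => ?_, fun w => ?_⟩
  · intro l hl l' hl' hd
    obtain ⟨k, -, rfl⟩ := Finset.mem_image.1 hl
    obtain ⟨k', -, rfl⟩ := Finset.mem_image.1 hl'
    have h3 : r k % N = r k' % N :=
      Int.emod_eq_emod_iff_emod_sub_eq_zero.2 (Int.emod_eq_zero_of_dvd hd)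
    simpa only [hr, Int.emod_emod] using h3
  · rw [div_mul_eq_mul_div, div_le_iff₀ hflR]
    refine (hlow w).trans ?_
    rw [mul_assoc, Finset.sum_mul]
    refine mul_le_mul_of_nonneg_left (Finset.sum_le_sum fun l' hl' => ?_) (by positivity)
    rw [mul_comm]
    exact mul_le_mul_of_nonneg_left (by exact_mod_cast hqf l' hl') (hφ0 w l')
  · refine le_trans ?_ (hupp w)
    refine mul_le_mul_of_nonneg_left (Finset.sum_le_sum fun l' hl' => ?_) (by positivity)
    exact le_mul_of_one_le_left (hφ0 w l') (by exact_mod_cast hq1 l' hl')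

/-! ### Products of frame constants -/

theorem exists_pos_forall_le_prod {u : ℕ → ℝ} (h0 : ∀ k, 0 < u k) (h1 : ∀ k, u k ≤ 1)
    (hs : Summable fun k => u k - 1) : ∃ A > 0, ∀ n, A ≤ ∏ k ∈ Finset.range n, u k := by
  have hlog : Summable fun k => Real.log (u k) := by
    simpa using Real.summable_log_one_add_of_summable hs
  refine ⟨Real.exp (∑' k, Real.log (u k)), Real.exp_pos _, fun n => ?_⟩
  have e : ∏ k ∈ Finset.range n, u k = Real.exp (∑ k ∈ Finset.range n, Real.log (u k)) := by
    rw [Real.exp_sum]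
    exact Finset.prod_congr rfl fun k _ => (Real.exp_log (h0 k)).symm
  rw [e, Real.exp_le_exp]
  have := hlog.neg.sum_le_tsum (Finset.range n) fun k _ =>
    neg_nonneg.2 (Real.log_nonpos (h0 k).le (h1 k))
  rw [tsum_neg, Finset.sum_neg_distrib] at this
  linarith

theorem prod_one_add_sq_le {ε : ℕ → ℝ} (h0 : ∀ k, 0 ≤ ε k) (hs : Summable ε) (n : ℕ) :
    ∏ k ∈ Finset.range n, (1 + ε k) ^ 2 ≤ Real.exp (2 * ∑' k, ε k) := by
  calc ∏ k ∈ Finset.range n, (1 + ε k) ^ 2 ≤ ∏ k ∈ Finset.range n, Real.exp (2 * ε k) := by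
        refine Finset.prod_le_prod (fun k _ => by positivity) fun k _ => ?_
        have := Real.add_one_le_exp (ε k)
        have h2 := h0 k
        rw [two_mul, Real.exp_add, ← sq]
        gcongr
        linarith
    _ = Real.exp (2 * ∑ k ∈ Finset.range n, ε k) := by rw [← Real.exp_sum, Finset.mul_sum]
    _ ≤ _ := by
        gcongr
        exact hs.sum_le_tsum _ fun k _ => h0 k

/-- The lower constants of a normalized frame triple tower have a convergent product: all but
finitely many of the factors `⌊(1 + ε k) ^ 2⌋` are `1`. -/
theorem exists_pos_forall_le_prod_one_sub_sq_div {ε : ℕ → ℝ} (h : ∀ k, 0 ≤ ε k ∧ ε k < 1)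
    (hs : Summable ε) :
    ∃ A > 0, ∀ n, A ≤ ∏ k ∈ Finset.range n, (1 - ε k) ^ 2 / (⌊(1 + ε k) ^ 2⌋₊ : ℝ) := by
  have hfl : ∀ k, (1 : ℝ) ≤ ⌊(1 + ε k) ^ 2⌋₊ := by
    intro k
    have : 1 ≤ ⌊(1 + ε k) ^ 2⌋₊ := Nat.le_floor (by have := (h k).1; push_cast; nlinarith)
    exact_mod_cast this
  refine exists_pos_forall_le_prod (fun k => ?_) (fun k => ?_) ?_
  · have := (h k).2
    exact div_pos (pow_pos (by linarith) 2) (by linarith [hfl k])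
  · rw [div_le_one (by linarith [hfl k])]
    have := h k
    nlinarith [hfl k]
  · refine Summable.of_norm_bounded_eventually_nat (hs.mul_left 2) ?_
    filter_upwards [hs.tendsto_atTop_zero.eventually_lt_const (by norm_num : (0 : ℝ) < 1 / 3)]
      with k hk
    have h0 := (h k).1
    have : ⌊(1 + ε k) ^ 2⌋₊ = 1 := by
      rw [Nat.floor_eq_iff (by positivity)]
      push_cast
      constructor <;> nlinarith
    rw [this, Nat.cast_one, div_one, Real.norm_eq_abs, abs_le]
    constructor <;> nlinarith

/-! ### Spectra and frame spectra -/

theorem memLp_exp (μ : Measure ℝ) [IsFiniteMeasure μ] (l : ℝ) :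
    MemLp (fun x : ℝ => Complex.exp (2 * Real.pi * Complex.I * l * x)) 2 μ := by
  refine MemLp.of_bound (Continuous.aestronglyMeasurable (by fun_prop)) 1 (ae_of_all _ fun x => ?_)
  rw [← conj_fexp, RCLike.norm_conj, norm_fexp]

theorem enorm_sq_eq_ofReal (z : ℂ) : ‖z‖ₑ ^ 2 = ENNReal.ofReal (‖z‖ ^ 2) := by
  rw [ENNReal.ofReal_pow (norm_nonneg _), ofReal_norm]

section Spectra

variable {μ : Measure ℝ} [IsProbabilityMeasure μ] {Λ : Set ℝ} {A C : ℝ}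

theorem isFrameSpectrum_of_real_bounds (hA : 0 < A)
    (h : ∀ f : ℝ → ℂ, MemLp f 2 μ → Summable (fun l : Λ => ‖∫ x, f x * fexp l x ∂μ‖ ^ 2) ∧
      A * ∫ x, ‖f x‖ ^ 2 ∂μ ≤ ∑' l : Λ, ‖∫ x, f x * fexp l x ∂μ‖ ^ 2 ∧
      ∑' l : Λ, ‖∫ x, f x * fexp l x ∂μ‖ ^ 2 ≤ C * ∫ x, ‖f x‖ ^ 2 ∂μ) :
    IsFrameSpectrum μ Λ := by
  have hAC : A ≤ C := by
    obtain ⟨-, h1, h2⟩ := h (fun _ => 1) (memLp_const 1)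
    simpa using h1.trans h2
  refine ⟨inferInstance, A.toNNReal, C.toNNReal, by simpa using hA, Real.toNNReal_le_toNNReal hAC,
    fun f hf => ?_⟩
  obtain ⟨h0, h1, h2⟩ := h f hf
  have e1 : ∫⁻ x, ‖f x‖ₑ ^ 2 ∂μ = ENNReal.ofReal (∫ x, ‖f x‖ ^ 2 ∂μ) := by
    simp_rw [enorm_sq_eq_ofReal]
    exact (ofReal_integral_eq_lintegral_ofReal ((memLp_two_iff_integrable_sq_norm hf.1).1 hf)
      (ae_of_all _ fun x => by positivity)).symm
  have e2 : ∑' l : Λ, ‖∫ x, f x * Complex.exp (-2 * Real.pi * Complex.I * (l : ℝ) * x) ∂μ‖ₑ ^ 2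
      = ENNReal.ofReal (∑' l : Λ, ‖∫ x, f x * fexp l x ∂μ‖ ^ 2) := by
    simp_rw [enorm_sq_eq_ofReal]
    exact (ENNReal.ofReal_tsum_of_nonneg (fun _ => by positivity) h0).symm
  rw [e1, e2]
  change ENNReal.ofReal A * _ ≤ _ ∧ _ ≤ ENNReal.ofReal C * _
  rw [← ENNReal.ofReal_mul hA.le, ← ENNReal.ofReal_mul (hA.le.trans hAC)]
  exact ⟨ENNReal.ofReal_le_ofReal h1, ENNReal.ofReal_le_ofReal h2⟩

/-- Exponentials that satisfy the frame inequalities with upper bound `1` form an orthonormal basis: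
the upper bound for one of these unit vectors leaves no room for nonzero inner products with the
others, and the lower bound gives completeness. -/
theorem isSpectrum_of_real_bounds (hΛ : Λ.Countable) (hA : 0 < A)
    (h : ∀ f : ℝ → ℂ, MemLp f 2 μ → Summable (fun l : Λ => ‖∫ x, f x * fexp l x ∂μ‖ ^ 2) ∧
      A * ∫ x, ‖f x‖ ^ 2 ∂μ ≤ ∑' l : Λ, ‖∫ x, f x * fexp l x ∂μ‖ ^ 2 ∧
      ∑' l : Λ, ‖∫ x, f x * fexp l x ∂μ‖ ^ 2 ≤ 1 * ∫ x, ‖f x‖ ^ 2 ∂μ) :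
    IsSpectrum μ Λ := by
  set e : Λ → Lp ℂ 2 μ := fun l => (memLp_exp μ l).toLp _ with he
  have hcoe : ∀ l : Λ, (e l : ℝ → ℂ) =ᵐ[μ] fun x =>
      Complex.exp (2 * Real.pi * Complex.I * (l : ℝ) * x) := fun l => (memLp_exp μ l).coeFn_toLp
  have hinner : ∀ (l : Λ) (f : Lp ℂ 2 μ), inner ℂ (e l) f = ∫ x, f x * fexp l x ∂μ := by
    intro l f
    rw [L2.inner_def]
    refine integral_congr_ae ?_
    filter_upwards [hcoe l] with x hx
    rw [hx, RCLike.inner_apply, ← conj_fexp, Complex.conj_conj]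
  have hnorm : ∀ f : Lp ℂ 2 μ, ‖f‖ ^ 2 = ∫ x, ‖f x‖ ^ 2 ∂μ := by
    intro f
    have h1 : ((‖f‖ ^ 2 : ℝ) : ℂ) = ∫ x, ((‖f x‖ ^ 2 : ℝ) : ℂ) ∂μ := by
      have := inner_self_eq_norm_sq_to_K (𝕜 := ℂ) f
      rw [L2.inner_def] at this
      push_cast
      rw [← Complex.coe_algebraMap, ← this]
      refine integral_congr_ae (ae_of_all _ fun x => ?_)
      exact inner_self_eq_norm_sq_to_K (𝕜 := ℂ) (f x)
    rw [integral_complex_ofReal] at h1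
    exact_mod_cast h1
  have hself : ∀ l : Λ, ‖e l‖ = 1 := by
    intro l
    have h1 : ‖e l‖ ^ 2 = 1 := by
      rw [hnorm]
      have : ∫ x, ‖e l x‖ ^ 2 ∂μ = ∫ _, (1 : ℝ) ∂μ := by
        refine integral_congr_ae ?_
        filter_upwards [hcoe l] with x hx
        rw [hx, ← conj_fexp, RCLike.norm_conj, norm_fexp, one_pow]
      simpa using this
    exact (pow_eq_one_iff_of_nonneg (norm_nonneg _) two_ne_zero).1 h1
  have horth : Orthonormal ℂ e := by
    refine ⟨hself, fun l l' hne => ?_⟩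
    obtain ⟨h0, -, h2⟩ := h (e l') (Lp.memLp _)
    simp_rw [← hinner] at h0 h2
    rw [← hnorm, hself] at h2
    classical
    have h3 := h0.sum_le_tsum {l, l'} fun _ _ => by positivity
    rw [Finset.sum_pair hne, inner_self_eq_norm_sq_to_K, hself] at h3
    simp only [RCLike.ofReal_one, one_pow, norm_one] at h3
    have h4 : ‖inner ℂ (e l) (e l')‖ ^ 2 ≤ 0 := by linarith
    simpa using h4.antisymm (by positivity)
  have hcomp : (Submodule.span ℂ (Set.range e))ᗮ = ⊥ := by
    rw [Submodule.eq_bot_iff]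
    intro f hf
    obtain ⟨-, h1, -⟩ := h f (Lp.memLp f)
    have h0 : ∀ l : Λ, ∫ x, f x * fexp l x ∂μ = 0 := fun l => by
      rw [← hinner]
      exact (Submodule.mem_orthogonal _ _).1 hf _ (Submodule.subset_span ⟨l, rfl⟩)
    simp only [h0, norm_zero, ne_eq, OfNat.ofNat_ne_zero, not_false_eq_true, zero_pow,
      tsum_zero, ← hnorm] at h1
    have h2 : ‖f‖ ^ 2 ≤ 0 := by nlinarith
    simpa using h2.antisymm (by positivity)
  refine ⟨inferInstance, hΛ, HilbertBasis.mkOfOrthogonalEqBot horth hcomp, fun l => ?_⟩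
  rw [HilbertBasis.coe_mkOfOrthogonalEqBot]
  exact hcoe l

end Spectra

theorem theorem1p3 (N : ℕ → ℕ) (B L : ℕ → Finset ℤ)
    (hne : ∀ n, (B n).Nonempty)
    (hB : ∀ n, B n ⊆ Finset.Ico 0 (N n : ℤ))
    (hρ : ¬ WeaklyConverges (rescaledTail N B) rhoMeasure) :
    ((∀ n, IsHadamardTriple (N n) (B n) (L n)) →
      IsSpectralMeasure (cantorMoran N B) ∧
        ∃ Λ : Set ℝ, Λ ⊆ Set.range (Int.cast : ℤ → ℝ) ∧ IsSpectrum (cantorMoran N B) Λ) ∧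
    (IsFrameTripleTower N B L →
      IsFrameSpectralMeasure (cantorMoran N B) ∧
        ∃ Λ : Set ℝ, Λ ⊆ Set.range (Int.cast : ℤ → ℝ) ∧ IsFrameSpectrum (cantorMoran N B) Λ) := by
  constructor
  · intro hH
    have hN : ∀ n, 2 ≤ N n := fun n => (hH n).two_le
    have := (weaklyConverges_cantorMoran hN hne hB).1
    have hF : ∀ n, DigitFrame (N n) (B n) (L n) 1 1 := fun n => by
      simpa using (hH n).isFrameTriple.digitFrame
    choose L' h0 hL hF' using fun n =>
      ((hF n).exists_normalized (by have := hN n; omega) (hne n) one_pos).2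
    simp only [Nat.floor_one, Nat.cast_one, div_one] at hF'
    obtain ⟨Λ, hΛ, A, hA, h⟩ := exists_fourierFrame (A := 1) (C := 1) hN hne hB hρ
      (fun _ => zero_le_one) (fun _ => zero_le_one) hF' h0 hL one_pos (by simp) (by simp)
    have hs := isSpectrum_of_real_bounds ((Set.countable_range _).mono hΛ) hA h
    exact ⟨⟨Λ, hs⟩, Λ, hΛ, hs⟩
  · rintro ⟨ε, hε, hsum, hT⟩
    have hN : ∀ n, 2 ≤ N n := fun n => (hT n).two_le
    have := (weaklyConverges_cantorMoran hN hne hB).1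
    choose L' h0 hL hF using fun n =>
      ((hT n).digitFrame.exists_normalized (by have := hN n; omega) (hne n)
        (pow_pos (hT n).pos 2)).2
    obtain ⟨A₀, hA₀, hA⟩ := exists_pos_forall_le_prod_one_sub_sq_div hε hsum
    obtain ⟨Λ, hΛ, A, hA, h⟩ := exists_fourierFrame hN hne hB hρ
      (fun n => by positivity) (fun n => by positivity) hF h0 hL hA₀ hA
      (prod_one_add_sq_le (fun k => (hε k).1) hsum)
    have hs := isFrameSpectrum_of_real_bounds hA h
    exact ⟨⟨Λ, hs⟩, Λ, hΛ, hs⟩
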